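/- Let $M$ be an oriented matroid on a finite linearly ordered set $E$. For $A\subseteq E$ let $-_AM$ be the reorientation of $M$ along $A$; reorientations of $M$ are identified with the subsets $A\subseteq E$ (so there are $2^{|E|}$ of them). For $F\subseteq G\subseteq E$ let $M(G)/F$ be the minor obtained by restricting to $G$ and contracting $F$; write $-_AM(G)/F$ for $(-_AM)(G)/F$. A positive (co)circuit is a signed (co)circuit all of whose signs are positive; (co)circuits are identified with their supports below. An oriented matroid $N$ is bounded with respect to an element $p$ if it has no positive circuit and every positive cocircuit contains $p$; it is dual-bounded with respect to $p$ if every element lies in a positive circuit and every positive circuit contains $p$. A connected filtration of $M$ is a sequence $(F'_\varepsilon,\dots,F'_0,F_c,F_0,\dots,F_\iota)$ of subsets of $E$ ($\varepsilon,\iota\ge 0$) such that $\emptyset=F'_\varepsilon\subsetneq\dots\subsetneq F'_0=F_c=F_0\subsetneq\dots\subsetneq F_\iota=E$; the sequences $\min(F_k\setminus F_{k-1})$, $1\le k\le\iota$, and $\min(F'_{k-1}\setminus F'_k)$, $1\le k\le\varepsilon$, are increasing in $k$; for $1\le k\le\iota$ the matroid underlying $M(F_k)/F_{k-1}$ is connected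 and is not a single loop; and for $1\le k\le\varepsilon$ the matroid underlying $M(F'_{k-1})/F'_k$ is connected and is not a single isthmus (coloop). The active filtration of an oriented matroid $N$ on $E$ is defined as follows. Let $a_1<\dots<a_\iota$ be the elements of $E$ that are the minimum of some positive cocircuit of $N$, and $a'_1<\dots<a'_\varepsilon$ those that are the minimum of some positive circuit of $N$. Then $F_c$ is the union of all positive circuits of $N$; $F'_k$ is the union of all positive circuits $C$ with $\min C\ge a'_{k+1}$ for $0\le k<\varepsilon$, and $F'_\varepsilon=\emptyset$; $F_k$ is the complement in $E$ of the union of all positive cocircuits $D$ with $\min D\ge a_{k+1}$ for $0\le k<\iota$, and $F_\iota=E$. Theorem. One has $$\bigl\{-_AM : A\subseteq E\bigr\}=\biguplus\Bigl\{-_AM \;:\; -_AM(F_k)/F_{k-1}\text{ is bounded with respect to }\min(F_k\setminus F_{k-1})\text{ for }1\le k\le\iota,\ \text{and } -_AM(F'_{k-1})/F'_k\text{ is dual-bounded with respect to }\min(F'_{k-1}\setminus F'_k)\text{ for }1\le k\le\varepsilon\Bigr\},$$ where the disjoint union is over all connected filtrations $(F'_\varepsilon,\dots,F'_0,F_c,F_0,\dots,F_\iota)$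 of $M$. Moreover, whenever $-_AM$ belongs to the set indexed by a connected filtration of $M$, this filtration is the active filtration of $-_AM$. -/

import Mathlib

/-- A signed subset of `α`: `X e` is `1`, `-1` or `0` according as `e` is a positive element, a
negative element, or not an element of the signed subset. -/
abbrev SignedSet (α : Type*) := α → SignType

namespace SignedSet

variable {α : Type*}

/-- The underlying (unsigned) set. -/
def supp (X : SignedSet α) : Set α := {e | X e ≠ 0}

/-- The separation set of two signed sets. -/
def sep (X Y : SignedSet α) : Set α := {e | X e ≠ 0 ∧ Y e = -X e}

/-- The composition `X ∘ Y`. -/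
def comp (X Y : SignedSet α) : SignedSet α := fun e => if X e = 0 then Y e else X e

/-- The restriction of a signed set to `F`. -/
def restr [DecidableEq α] (F : Finset α) (X : SignedSet α) : SignedSet α :=
  fun e => if e ∈ F then X e else 0

/-- The signed set obtained by reversing the signs of the elements of `A`. -/
def flip [DecidableEq α] (A : Finset α) (X : SignedSet α) : SignedSet α :=
  fun e => if e ∈ A then -X e else X e

/-- Orthogonality: either the supports are disjoint, or there are elements of the intersection
of the supports on which the signs agree and elements on which they are opposite. -/
def Orth (X Y : SignedSet α) : Prop :=
  (∃ e, X e * Y e = 1) ↔ (∃ e, X e * Y e = -1)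

/-- All signs are positive. -/
def IsPositive (X : SignedSet α) : Prop := ∀ e ∈ X.supp, X e = 1

end SignedSet

/-- An oriented matroid on a finite ground set, given by the covector axioms. -/
structure OrientedMatroid (α : Type*) where
  /-- the ground set `E` -/
  ground : Finset α
  /-- the set of covectors, which are signed subsets of `E` -/
  covectors : Set (SignedSet α)
  supp_subset : ∀ X ∈ covectors, X.supp ⊆ ground
  zero_mem : (0 : SignedSet α) ∈ covectors
  neg_mem : ∀ X ∈ covectors, -X ∈ covectors
  comp_mem : ∀ X ∈ covectors, ∀ Y ∈ covectors, X.comp Y ∈ covectors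
  elim : ∀ X ∈ covectors, ∀ Y ∈ covectors, ∀ e ∈ X.sep Y,
    ∃ Z ∈ covectors, Z e = 0 ∧ ∀ f ∉ X.sep Y, Z f = X.comp Y f

namespace OrientedMatroid

section Basic

variable {α : Type*}

/-- The vectors: signed subsets of `E` orthogonal to all the covectors. -/
def vectors (M : OrientedMatroid α) : Set (SignedSet α) :=
  {X | X.supp ⊆ M.ground ∧ ∀ Y ∈ M.covectors, X.Orth Y}

/-- The (signed) circuits: the nonzero vectors with inclusion-minimal support. -/
def IsCircuit (M : OrientedMatroid α) (C : SignedSet α) : Prop :=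
  C ∈ M.vectors ∧ C ≠ 0 ∧ ∀ X ∈ M.vectors, X ≠ 0 → X.supp ⊆ C.supp → X.supp = C.supp

/-- The (signed) cocircuits: the nonzero covectors with inclusion-minimal support. -/
def IsCocircuit (M : OrientedMatroid α) (D : SignedSet α) : Prop :=
  D ∈ M.covectors ∧ D ≠ 0 ∧ ∀ X ∈ M.covectors, X ≠ 0 → X.supp ⊆ D.supp → X.supp = D.supp

def IsPosCircuit (M : OrientedMatroid α) (C : SignedSet α) : Prop := M.IsCircuit C ∧ C.IsPositive

def IsPosCocircuit (M : OrientedMatroid α) (D : SignedSet α) : Prop :=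
  M.IsCocircuit D ∧ D.IsPositive

/-- No positive circuit. -/
def IsAcyclic (M : OrientedMatroid α) : Prop := ∀ C, ¬ M.IsPosCircuit C

/-- Every element belongs to a positive circuit. -/
def IsTotallyCyclic (M : OrientedMatroid α) : Prop :=
  ∀ e ∈ M.ground, ∃ C, M.IsPosCircuit C ∧ e ∈ C.supp

/-- `M` is bounded with respect to `p`. -/
def IsBoundedAt (M : OrientedMatroid α) (p : α) : Prop :=
  p ∈ M.ground ∧ M.IsAcyclic ∧ ∀ D, M.IsPosCocircuit D → p ∈ D.supp

/-- `M` is dual-bounded with respect to `p`. -/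
def IsDualBoundedAt (M : OrientedMatroid α) (p : α) : Prop :=
  p ∈ M.ground ∧ M.IsTotallyCyclic ∧ ∀ C, M.IsPosCircuit C → p ∈ C.supp

/-- The underlying matroid, whose circuits are the supports of the signed circuits, is connected:
any two distinct elements lie in a common circuit. -/
def IsConnected (M : OrientedMatroid α) : Prop :=
  ∀ e ∈ M.ground, ∀ f ∈ M.ground, e ≠ f → ∃ C, M.IsCircuit C ∧ e ∈ C.supp ∧ f ∈ C.supp

/-- `M` has a unique element, and this element is a loop. -/
def IsLoop (M : OrientedMatroid α) : Prop :=
  ∃ e, M.ground = {e} ∧ ∃ C, M.IsCircuit C ∧ C.supp = {e}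

/-- `M` has a unique element, and this element is an isthmus (coloop). -/
def IsIsthmus (M : OrientedMatroid α) : Prop :=
  ∃ e, M.ground = {e} ∧ ∃ D, M.IsCocircuit D ∧ D.supp = {e}

end Basic

section Operations

variable {α : Type*} [DecidableEq α]

/-- The reorientation `-_A M`. -/
def reorient (M : OrientedMatroid α) (A : Finset α) : OrientedMatroid α where
  ground := M.ground
  covectors := {X | X.flip A ∈ M.covectors}
  supp_subset X hX e he := by
    refine M.supp_subset _ hX ?_
    simp only [SignedSet.supp, Set.mem_ofPred_eq, SignedSet.flip] at he ⊢
    split_ifs <;> simpa using he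
  zero_mem := by
    have h : SignedSet.flip A (0 : SignedSet α) = 0 := by
      funext e; simp [SignedSet.flip]
    simpa [h] using M.zero_mem
  neg_mem X hX := by
    have h : SignedSet.flip A (-X) = -SignedSet.flip A X := by
      funext e; simp only [SignedSet.flip, Pi.neg_apply]; split_ifs <;> rfl
    simpa [h] using M.neg_mem _ hX
  comp_mem X hX Y hY := by
    have h : SignedSet.flip A (X.comp Y) = (X.flip A).comp (Y.flip A) := by
      funext e; simp only [SignedSet.flip, SignedSet.comp]; split_ifs <;> simp_all
    simpa [h] using M.comp_mem _ hX _ hY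
  elim X hX Y hY e he := by
    have hs : (X.flip A).sep (Y.flip A) = X.sep Y := by
      ext f; simp only [SignedSet.sep, SignedSet.flip, Set.mem_ofPred_eq]
      split_ifs <;> simp [neg_eq_iff_eq_neg]
    obtain ⟨Z, hZ, hZe, hZf⟩ := M.elim _ hX _ hY e (hs ▸ he)
    have hZZ : (Z.flip A).flip A = Z := by
      funext f; simp only [SignedSet.flip]; split_ifs <;> simp
    refine ⟨Z.flip A, by simpa [hZZ] using hZ, by simp [SignedSet.flip, hZe], fun f hf => ?_⟩
    have := hZf f (hs ▸ hf)
    simp only [SignedSet.flip, SignedSet.comp] at this ⊢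
    split_ifs at this ⊢ <;> simp_all

/-- The restriction `M(F)`, that is, the deletion of the elements outside `F`: its covectors are
the restrictions to `F` of the covectors of `M`. -/
def restrict (M : OrientedMatroid α) (F : Finset α) : OrientedMatroid α where
  ground := M.ground ∩ F
  covectors := SignedSet.restr F '' M.covectors
  supp_subset := by
    rintro _ ⟨X, hX, rfl⟩ e he
    simp only [SignedSet.supp, Set.mem_ofPred_eq, SignedSet.restr] at he
    split_ifs at he with h
    · exact Finset.mem_coe.2 (Finset.mem_inter.2 ⟨M.supp_subset X hX he, h⟩)
    · exact absurd rfl he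
  zero_mem := ⟨0, M.zero_mem, by funext e; simp [SignedSet.restr]⟩
  neg_mem := by
    rintro _ ⟨X, hX, rfl⟩
    refine ⟨-X, M.neg_mem X hX, ?_⟩
    funext e; simp only [SignedSet.restr, Pi.neg_apply]; split_ifs <;> rfl
  comp_mem := by
    rintro _ ⟨X, hX, rfl⟩ _ ⟨Y, hY, rfl⟩
    refine ⟨X.comp Y, M.comp_mem X hX Y hY, ?_⟩
    funext e; simp only [SignedSet.restr, SignedSet.comp]; split_ifs <;> simp_all
  elim := by
    rintro _ ⟨X, hX, rfl⟩ _ ⟨Y, hY, rfl⟩ e he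
    have heF : e ∈ F := by
      by_contra h
      exact he.1 (by simp [SignedSet.restr, h])
    have he' : e ∈ X.sep Y := by
      simpa [SignedSet.sep, SignedSet.restr, heF] using he
    obtain ⟨Z, hZ, hZe, hZf⟩ := M.elim X hX Y hY e he'
    refine ⟨_, ⟨Z, hZ, rfl⟩, by simp [SignedSet.restr, hZe], fun f hf => ?_⟩
    by_cases hfF : f ∈ F
    · have hf' : f ∉ X.sep Y := by
        simpa [SignedSet.sep, SignedSet.restr, hfF] using hf
      simpa [SignedSet.restr, SignedSet.comp, hfF] using hZf f hf'
    · simp [SignedSet.restr, SignedSet.comp, hfF]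

/-- The contraction `M / F`: its covectors are the covectors of `M` that vanish on `F`. -/
def contract (M : OrientedMatroid α) (F : Finset α) : OrientedMatroid α where
  ground := M.ground \ F
  covectors := {X | X ∈ M.covectors ∧ ∀ e ∈ F, X e = 0}
  supp_subset := by
    rintro X ⟨hX, h0⟩ e he
    exact Finset.mem_coe.2 (Finset.mem_sdiff.2 ⟨M.supp_subset X hX he, fun h => he (h0 e h)⟩)
  zero_mem := ⟨M.zero_mem, fun _ _ => rfl⟩
  neg_mem := by
    rintro X ⟨hX, h0⟩
    exact ⟨M.neg_mem X hX, fun e he => by simp [h0 e he]⟩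
  comp_mem := by
    rintro X ⟨hX, hX0⟩ Y ⟨hY, hY0⟩
    exact ⟨M.comp_mem X hX Y hY, fun e he => by simp [SignedSet.comp, hX0 e he, hY0 e he]⟩
  elim := by
    rintro X ⟨hX, hX0⟩ Y ⟨hY, hY0⟩ e he
    obtain ⟨Z, hZ, hZe, hZf⟩ := M.elim X hX Y hY e he
    refine ⟨Z, ⟨hZ, fun f hf => ?_⟩, hZe, hZf⟩
    rw [hZf f (fun h => h.1 (hX0 f hf))]
    simp [SignedSet.comp, hX0 f hf, hY0 f hf]

/-- The minor `M(G) / F`. -/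
def minor (M : OrientedMatroid α) (G F : Finset α) : OrientedMatroid α :=
  (M.restrict G).contract F

end Operations

end OrientedMatroid

/-- A sequence of sets `(F'_ε, …, F'_0, F_c, F_0, …, F_ι)`; `F' k` stands for `F'_k` and `F k`
for `F_k`. -/
structure SetSeq (α : Type*) where
  ε : ℕ
  ι : ℕ
  F' : Fin (ε + 1) → Finset α
  Fc : Finset α
  F : Fin (ι + 1) → Finset α

namespace SetSeq

variable {α : Type*} [DecidableEq α]

/-- The part `F_k \ F_{k-1}`, with `k : Fin ι` standing for the index `k + 1` in `1, …, ι`. -/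
def part (S : SetSeq α) (k : Fin S.ι) : Finset α := S.F k.succ \ S.F k.castSucc

/-- The part `F'_{k-1} \ F'_k`, with `k : Fin ε` standing for the index `k + 1` in `1, …, ε`. -/
def part' (S : SetSeq α) (k : Fin S.ε) : Finset α := S.F' k.castSucc \ S.F' k.succ

end SetSeq

namespace OrientedMatroid

variable {α : Type*} [LinearOrder α]

/-- `S` is a filtration of (the ground set of) `M`:
`∅ = F'_ε ⊂ … ⊂ F'_0 = F_c = F_0 ⊂ … ⊂ F_ι = E`, and the minima of the successive differences
`F_k \ F_{k-1}`, and those of `F'_{k-1} \ F'_k`, increase with `k`. -/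
structure IsFiltration (M : OrientedMatroid α) (S : SetSeq α) : Prop where
  F'_last : S.F' (Fin.last S.ε) = ∅
  F'_strictAnti : StrictAnti S.F'
  F'_zero : S.F' 0 = S.Fc
  F_zero : S.F 0 = S.Fc
  F_strictMono : StrictMono S.F
  F_last : S.F (Fin.last S.ι) = M.ground
  min_part : StrictMono fun k : Fin S.ι => (S.part k).min
  min_part' : StrictMono fun k : Fin S.ε => (S.part' k).min

/-- `S` is a connected filtration of `M`. -/
structure IsConnectedFiltration (M : OrientedMatroid α) (S : SetSeq α) : Prop
    extends M.IsFiltration S where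
  connected : ∀ k : Fin S.ι, (M.minor (S.F k.succ) (S.F k.castSucc)).IsConnected ∧
    ¬ (M.minor (S.F k.succ) (S.F k.castSucc)).IsLoop
  connected' : ∀ k : Fin S.ε, (M.minor (S.F' k.castSucc) (S.F' k.succ)).IsConnected ∧
    ¬ (M.minor (S.F' k.castSucc) (S.F' k.succ)).IsIsthmus

/-- The minors `M(F_k) / F_{k-1}` are bounded with respect to `min (F_k \ F_{k-1})`, and the minors
`M(F'_{k-1}) / F'_k` are dual-bounded with respect to `min (F'_{k-1} \ F'_k)`. -/
def HasBoundedMinors (M : OrientedMatroid α) (S : SetSeq α) : Prop :=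
  (∀ k : Fin S.ι, ∃ p : α, (S.part k).min = p ∧
    (M.minor (S.F k.succ) (S.F k.castSucc)).IsBoundedAt p) ∧
  (∀ k : Fin S.ε, ∃ p : α, (S.part' k).min = p ∧
    (M.minor (S.F' k.castSucc) (S.F' k.succ)).IsDualBoundedAt p)

open Classical in
/-- The set `O(M)` of active elements. -/
noncomputable def active (M : OrientedMatroid α) : Finset α :=
  M.ground.filter fun a => ∃ C, M.IsPosCircuit C ∧ IsLeast C.supp a

open Classical in
/-- The set `O*(M)` of dual-active elements. -/
noncomputable def dualActive (M : OrientedMatroid α) : Finset α :=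
  M.ground.filter fun a => ∃ D, M.IsPosCocircuit D ∧ IsLeast D.supp a

open Classical in
/-- The union of the positive circuits. -/
noncomputable def cyclicPart (M : OrientedMatroid α) : Finset α :=
  M.ground.filter fun e => ∃ C, M.IsPosCircuit C ∧ e ∈ C.supp

open Classical in
/-- The union of the positive circuits whose smallest element is at least `a`. -/
noncomputable def circuitUnion (M : OrientedMatroid α) (a : α) : Finset α :=
  M.ground.filter fun e => ∃ C, M.IsPosCircuit C ∧ (∀ x ∈ C.supp, a ≤ x) ∧ e ∈ C.supp

open Classical in
/-- The union of the positive cocircuits whose smallest element is at least `a`. -/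
noncomputable def cocircuitUnion (M : OrientedMatroid α) (a : α) : Finset α :=
  M.ground.filter fun e => ∃ D, M.IsPosCocircuit D ∧ (∀ x ∈ D.supp, a ≤ x) ∧ e ∈ D.supp

/-- The active filtration of `M`. With `a_1 < … < a_ι` the dual-active and `a'_1 < … < a'_ε` the
active elements (enumerated from index `0` by `Finset.orderEmbOfFin`): `F'_k` for `k < ε` is the
union of the positive circuits with minimum at least `a'_{k+1}`, `F'_ε = ∅`, `F_c` is the union of
all the positive circuits, `F_k` for `k < ι` is the complement of the union of the positive
cocircuits with minimum at least `a_{k+1}`, and `F_ι = E`. -/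
noncomputable def activeFiltration (M : OrientedMatroid α) : SetSeq α where
  ε := M.active.card
  ι := M.dualActive.card
  F' k := if h : (k : ℕ) < M.active.card then
      M.circuitUnion (M.active.orderEmbOfFin rfl ⟨k, h⟩)
    else ∅
  Fc := M.cyclicPart
  F k := if h : (k : ℕ) < M.dualActive.card then
      M.ground \ M.cocircuitUnion (M.dualActive.orderEmbOfFin rfl ⟨k, h⟩)
    else M.ground

/-- The set of reorientations `-_A M` of `M`. A reorientation is identified with the subset
`A` of the ground set, so that there are `2 ^ |E|` of them. -/
def reorientations (M : OrientedMatroid α) : Set (Finset α) := {A | A ⊆ M.ground}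

/-- The reorientations `-_A M` whose minors induced by `S` are bounded, respectively dual-bounded,
with respect to their smallest elements. -/
def boundedReorientations (M : OrientedMatroid α) (S : SetSeq α) : Set (Finset α) :=
  {A | A ∈ M.reorientations ∧ (M.reorient A).HasBoundedMinors S}

end OrientedMatroid

/-! ### Signed sets: orthogonality, positivity, composition. -/

namespace SignedSet

variable {α : Type*}

/-! Reorientation preserves connectedness, loops and isthmuses and commutes with minors, so it
suffices to treat `M` itself and prove two facts: the active filtration is a filtration with bounded
and dual-bounded minors, and it is the only such filtration. Connectedness comes for free: a bounded
minor is connected and not a loop, and dually (`IsBoundedAt.isConnected`, `IsBoundedAt.not_isLoop`).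
Disjointness of the union is then part of uniqueness.

Duality halves the work. The decreasing half of a filtration, complemented, is an increasing chain
for the dual, and dual-bounded becomes bounded (`isBoundedChain_dual_iff`). This needs the vectors
to form an oriented matroid whose dual is `M` again and whose minors are dual to those of `M`; all
of it rests on Farkas' lemma (`farkas`), obtained from composition and elimination of covectors.

Uniqueness (`IsBoundedChain.eq_activeFlat`): composing positive covectors of the acyclic minors
gives, for each set of the chain, a positive covector supported on its complement. Conversely, a
positive covector vanishing up to some set of the chain but not up to the next restricts to a
nonzero positive covector of a bounded minor, so it contains the minimum of that part. Hence these
minima are exactly the dual-active elements, and they determine the chain.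

Existence (`isBoundedChain_activeFlat`): a positive cocircuit of a minor that missed its active
element could be composed with a positive covector supported outside the larger set; the result
would have its dual-active elements too large for its support to meet that set. -/

theorem Orth.symm {X Y : SignedSet α} (h : X.Orth Y) : Y.Orth X := by
  simpa only [Orth, mul_comm] using h

theorem orth_congr {X Y X' Y' : SignedSet α} (h : ∀ e, X e * Y e = X' e * Y' e) :
    X.Orth Y ↔ X'.Orth Y' := by
  simp only [Orth, h]

theorem isPositive_iff {X : SignedSet α} : X.IsPositive ↔ ∀ e, X e = 0 ∨ X e = 1 := by
  simp only [IsPositive, supp, Set.mem_ofPred_eq]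
  exact forall_congr' fun e => by tauto

theorem mem_supp {X : SignedSet α} {e : α} : e ∈ X.supp ↔ X e ≠ 0 := Iff.rfl

theorem ne_zero_of_apply {X : SignedSet α} {e : α} (h : X e ≠ 0) : X ≠ 0 :=
  fun h0 => h (by simp [h0])

theorem exists_apply_ne_zero {X : SignedSet α} (h : X ≠ 0) : ∃ e, X e ≠ 0 := by
  by_contra! h'
  exact h (funext h')

theorem supp_neg (X : SignedSet α) : (-X).supp = X.supp := by
  ext e; simp [supp]

/-- A family of signed sets closed under composition whose members conform with `σ` on `T` has a
member which agrees with `σ` wherever on `T` some member does. -/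
theorem exists_forall_eq_of_comp_mem {S : Set (SignedSet α)} {σ : SignedSet α} (h0 : 0 ∈ S)
    (hcomp : ∀ X ∈ S, ∀ Y ∈ S, X.comp Y ∈ S) (T : Finset α)
    (hconf : ∀ X ∈ S, ∀ e ∈ T, X e = 0 ∨ X e = σ e) (h : ∀ e ∈ T, ∃ X ∈ S, X e = σ e) :
    ∃ X ∈ S, ∀ e ∈ T, X e = σ e := by
  classical
  induction T using Finset.induction_on with
  | empty => exact ⟨0, h0, by simp⟩
  | insert a T _ ih =>
    obtain ⟨X, hX, hXe⟩ := ih (fun X hX e he => hconf X hX e (Finset.mem_insert_of_mem he))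
      (fun e he => h e (Finset.mem_insert_of_mem he))
    obtain ⟨Y, hY, hYe⟩ := h a (Finset.mem_insert_self a T)
    refine ⟨Y.comp X, hcomp Y hY X hX, fun e he => ?_⟩
    by_cases hY0 : Y e = 0
    · rcases Finset.mem_insert.1 he with rfl | he'
      · rcases hconf X hX e he with h1 | h1
        · simp [comp, hY0, h1, ← hYe]
        · simp [comp, hY0, h1]
      · simp [comp, hY0, hXe e he']
    · simpa [comp, hY0] using (hconf Y hY e he).resolve_left hY0

end SignedSet

/-! ### Lifting vectors from contractions, and Farkas' lemma. -/

namespace OrientedMatroid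

open SignedSet

variable {α : Type*}

theorem ext_covectors {M N : OrientedMatroid α} (hg : M.ground = N.ground)
    (hc : ∀ X, X ∈ M.covectors ↔ X ∈ N.covectors) : M = N := by
  cases M; cases N
  obtain rfl : _ = _ := hg
  obtain rfl : _ = _ := Set.ext hc
  rfl

theorem apply_eq_zero_of_notMem {M : OrientedMatroid α} {X : SignedSet α}
    (hX : X.supp ⊆ M.ground) {e : α} (he : e ∉ M.ground) : X e = 0 := by
  by_contra h
  exact he (hX h)

theorem mem_vectors_iff {M : OrientedMatroid α} {X : SignedSet α} :
    X ∈ M.vectors ↔ X.supp ⊆ M.ground ∧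
      ∀ Y ∈ M.covectors, ∀ e, X e * Y e = 1 → ∃ f, X f * Y f = -1 := by
  refine and_congr_right fun _ => ⟨fun h Y hY e he => (h Y hY).1 ⟨e, he⟩, fun h Y hY =>
    ⟨fun ⟨e, he⟩ => h Y hY e he, fun ⟨e, he⟩ => ?_⟩⟩
  obtain ⟨f, hf⟩ := h (-Y) (M.neg_mem Y hY) e (by simp [he])
  exact ⟨f, by simpa using hf⟩

section Lift

variable [DecidableEq α]

/-- A signed set orthogonal to the covectors vanishing at `b` becomes a vector after changing
its value at `b`. -/
theorem exists_vector_of_orth_apply_eq_zero {M : OrientedMatroid α} {X : SignedSet α} {b : α}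
    (hXs : X.supp ⊆ M.ground) (hXb : X b = 0)
    (hX : ∀ Y ∈ M.covectors, Y b = 0 → X.Orth Y) :
    ∃ X' ∈ M.vectors, ∀ f, f ≠ b → X' f = X f := by
  by_contra! hcon
  have hX0 : X ∉ M.vectors := fun h => by
    obtain ⟨f, _, hf⟩ := hcon X h
    exact hf rfl
  rw [mem_vectors_iff] at hX0
  push Not at hX0
  obtain ⟨Y₀, hY₀, e₀, he₀, hn₀⟩ := hX0 hXs
  have hb₀ : Y₀ b ≠ 0 := fun h => by
    obtain ⟨f, hf⟩ := (hX Y₀ hY₀ h).1 ⟨e₀, he₀⟩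
    exact hn₀ f hf
  -- The value `0` at `b` fails because of `Y₀`. The value `-Y₀ b` repairs that failure, so it must
  -- fail because of some `Y₁` with `Y₁ b = -Y₀ b`; eliminating `b` between `Y₀` and `Y₁` then
  -- contradicts `hX`.
  have hX1 : Function.update X b (-Y₀ b) ∉ M.vectors := fun h => by
    obtain ⟨f, hfb, hf⟩ := hcon _ h
    exact hf (by simp [hfb])
  rw [mem_vectors_iff] at hX1
  push Not at hX1
  obtain ⟨Y₁, hY₁, e₁, he₁, hn₁⟩ := hX1 (by
    intro f hf
    by_cases hfb : f = b
    · exact hfb ▸ M.supp_subset _ hY₀ hb₀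
    · exact hXs (by simpa [supp, hfb] using hf))
  have hn₁' : ∀ f, X f * Y₁ f ≠ -1 := fun f => by
    by_cases hfb : f = b
    · simp [hfb, hXb]
    · simpa [hfb] using hn₁ f
  have hb₁ : Y₁ b = -Y₀ b := by
    have h1 := hn₁ b
    have h2 : Y₁ b ≠ 0 := fun h => by
      have he : e₁ ≠ b := by rintro rfl; simp [h] at he₁
      obtain ⟨f, hf⟩ := (hX Y₁ hY₁ h).1 ⟨e₁, by simpa [he] using he₁⟩
      exact hn₁' f hf
    rw [Function.update_self] at h1
    revert h1 h2 hb₀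
    generalize Y₀ b = x; generalize Y₁ b = y
    revert x y; decide
  obtain ⟨Z, hZ, hZb, hZf⟩ := M.elim Y₀ hY₀ Y₁ hY₁ b ⟨hb₀, hb₁⟩
  -- Where `Y₀` and `Y₁` are opposite, a nonzero `X f` would give the product `-1` with one of them.
  -- So the eliminated covector is known on all of the support of `X`.
  have hsep : ∀ f, X f ≠ 0 → f ∉ Y₀.sep Y₁ := by
    rintro f hf ⟨h1, h2⟩
    have h3 := hn₀ f
    have h4 := hn₁' f
    rw [h2] at h4
    generalize X f = x at *; generalize Y₀ f = y at *
    clear h2; revert x y; decide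
  have hZ1 : X e₀ * Z e₀ = 1 := by
    have h1 : X e₀ ≠ 0 := by intro h; simp [h] at he₀
    have h2 : Y₀ e₀ ≠ 0 := by intro h; simp [h] at he₀
    rw [hZf e₀ (hsep e₀ h1)]
    simpa [comp, h2] using he₀
  obtain ⟨f, hf⟩ := (hX Z hZ hZb).1 ⟨e₀, hZ1⟩
  have h1 : X f ≠ 0 := by intro h; simp [h] at hf
  rw [hZf f (hsep f h1)] at hf
  simp only [comp] at hf
  split_ifs at hf
  · exact hn₁' f hf
  · exact hn₀ f hf

/-- The contracted elements are put back one at a time, each receiving a suitable sign. -/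
theorem exists_vector_of_contract {M : OrientedMatroid α} (B : Finset α) {X : SignedSet α}
    (hX : X ∈ (M.contract B).vectors) : ∃ X' ∈ M.vectors, ∀ f ∉ B, X' f = X f := by
  induction B using Finset.induction_on generalizing X with
  | empty =>
    refine ⟨X, ⟨fun e he => ?_, fun Y hY => hX.2 Y ⟨hY, by simp⟩⟩, fun _ _ => rfl⟩
    have := hX.1 he
    simpa [contract] using this
  | insert b B _ ih =>
    have hg : ∀ e ∈ X.supp, e ∈ M.ground ∧ e ≠ b ∧ e ∉ B := fun e he => by
      simpa [contract] using hX.1 he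
    have hb : X b = 0 := by
      by_contra h
      exact (hg b h).2.1 rfl
    obtain ⟨X₁, hX₁, h₁⟩ := exists_vector_of_orth_apply_eq_zero (M := M.contract B) (X := X)
      (b := b) (fun e he => by simpa [contract] using ⟨(hg e he).1, (hg e he).2.2⟩) hb
      (fun Y hY hYb => hX.2 Y ⟨hY.1, by
        intro e he
        rcases Finset.mem_insert.1 he with rfl | he
        · exact hYb
        · exact hY.2 e he⟩)
    obtain ⟨X₂, hX₂, h₂⟩ := ih hX₁
    refine ⟨X₂, hX₂, fun f hf => ?_⟩
    rw [Finset.mem_insert, not_or] at hf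
    rw [h₂ f hf.2, h₁ f hf.1]

end Lift

/-- Farkas' lemma without free elements for the vector. -/
theorem exists_covector_or_vector_of_conform (M : OrientedMatroid α) {σ : SignedSet α}
    (hσ : σ.supp ⊆ M.ground) {e : α} (he : σ e ≠ 0) :
    (∃ Y ∈ M.covectors, Y e = σ e ∧ ∀ f, σ f ≠ 0 → Y f = 0 ∨ Y f = σ f) ∨
    (∃ X ∈ M.vectors, X e = σ e ∧ ∀ f, X f = 0 ∨ X f = σ f) := by
  classical
  let S : Set (SignedSet α) := {Y | Y ∈ M.covectors ∧ ∀ f, σ f ≠ 0 → Y f = 0 ∨ Y f = σ f}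
  have hcomp : ∀ X ∈ S, ∀ Y ∈ S, X.comp Y ∈ S := fun X hX Y hY =>
    ⟨M.comp_mem X hX.1 Y hY.1, fun f hf => by
      by_cases h : X f = 0
      · simpa [comp, h] using hY.2 f hf
      · simpa [comp, h] using hX.2 f hf⟩
  -- `Y₀` agrees with `σ` at every element of its support where some member of `S` does. If it
  -- misses `e`, then `σ` restricted to the zeros of `Y₀` is a vector: a covector `Z` violating
  -- orthogonality would make `Y₀.comp Z` a member of `S` that agrees with `σ` at a new element.
  obtain ⟨Y₀, hY₀, hY₀e⟩ := exists_forall_eq_of_comp_mem (S := S) (σ := σ)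
    ⟨M.zero_mem, fun _ _ => Or.inl rfl⟩ hcomp
    (M.ground.filter fun f => σ f ≠ 0 ∧ ∃ Y ∈ S, Y f = σ f)
    (fun X hX e he => hX.2 e (Finset.mem_filter.1 he).2.1)
    (fun e he => (Finset.mem_filter.1 he).2.2)
  have hmax : ∀ f, σ f ≠ 0 → ∀ Y ∈ S, Y f = σ f → Y₀ f = σ f := fun f hf Y hY hYf =>
    hY₀e f (Finset.mem_filter.2 ⟨hσ hf, hf, Y, hY, hYf⟩)
  by_cases h0 : Y₀ e = σ e
  · exact Or.inl ⟨Y₀, hY₀.1, h0, hY₀.2⟩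
  refine Or.inr ⟨fun f => if Y₀ f = 0 then σ f else 0, ?_, ?_, fun f => ?_⟩
  · refine mem_vectors_iff.2 ⟨fun f hf => hσ ?_, fun Z hZ f hf => ?_⟩
    · simp only [supp, Set.mem_ofPred_eq] at hf ⊢
      intro h; simp [h] at hf
    · by_contra! hcon
      have hf0 : Y₀ f = 0 := by
        by_contra h; simp [h] at hf
      rw [if_pos hf0] at hf
      have hσf : σ f ≠ 0 := by intro h; simp [h] at hf
      have hmem : Y₀.comp Z ∈ S := ⟨M.comp_mem _ hY₀.1 _ hZ, fun g hg => by
        by_cases h : Y₀ g = 0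
        · have h1 := hcon g
          rw [if_pos h] at h1
          simp only [comp, h, if_true]
          generalize σ g = x at *; generalize Z g = y at *
          clear h hf; revert x y; decide
        · simpa [comp, h] using hY₀.2 g hg⟩
      have := hmax f hσf _ hmem (by
        simp only [comp, hf0, if_true]
        generalize σ f = x at *; generalize Z f = y at *
        revert hf; revert x y; decide)
      exact hσf (this ▸ hf0)
  · simp [(hY₀.2 e he).resolve_right h0]
  · dsimp only
    split_ifs
    · exact Or.inr rfl
    · exact Or.inl rfl

/-- Farkas' lemma, in painting form: the elements of the support of `σ` carry a prescribed sign,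
those of `B` are free for the vector and forbidden for the covector, and the others are free for
the covector and forbidden for the vector. -/
theorem farkas [DecidableEq α] (M : OrientedMatroid α) {σ : SignedSet α} (B : Finset α)
    (hσ : σ.supp ⊆ M.ground) (hB : ∀ f ∈ B, σ f = 0) {e : α} (he : σ e ≠ 0) :
    (∃ Y ∈ M.covectors, Y e = σ e ∧ (∀ f, σ f ≠ 0 → Y f = 0 ∨ Y f = σ f) ∧ ∀ f ∈ B, Y f = 0) ∨
    (∃ X ∈ M.vectors, X e = σ e ∧ ∀ f ∉ B, X f = 0 ∨ X f = σ f) := by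
  -- Contracting `B` forbids it to covectors; lifting back from the contraction leaves it free for
  -- vectors.
  rcases (M.contract B).exists_covector_or_vector_of_conform (σ := σ)
    (fun f hf => by simpa [contract] using ⟨hσ hf, fun h => hf (hB f h)⟩) he with
    ⟨Y, hY, hYe, hYf⟩ | ⟨X, hX, hXe, hXf⟩
  · exact Or.inl ⟨Y, hY.1, hYe, hYf, hY.2⟩
  · obtain ⟨X', hX', h⟩ := exists_vector_of_contract B hX
    exact Or.inr ⟨X', hX', by rw [h e fun h => he (hB e h), hXe], fun f hf => h f hf ▸ hXf f⟩

/-! ### Duality, and conformal circuits and cocircuits. -/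

/-- If `X` meets the support of a covector, both product signs already occur on `X` and survive in
the composition. Otherwise the products are those of `Y`. -/
theorem comp_mem_vectors {M : OrientedMatroid α} {X Y : SignedSet α} (hX : X ∈ M.vectors)
    (hY : Y ∈ M.vectors) : X.comp Y ∈ M.vectors := by
  refine mem_vectors_iff.2 ⟨fun e he => ?_, fun Z hZ e he => ?_⟩
  · by_cases h : X e = 0
    · exact hY.1 (by simpa [supp, comp, h] using he)
    · exact hX.1 h
  · by_cases h : ∃ f, X f * Z f = -1
    · obtain ⟨f, hf⟩ := h
      have : X f ≠ 0 := by intro h; simp [h] at hf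
      exact ⟨f, by simpa [comp, this] using hf⟩
    · have h1 : ¬ ∃ f, X f * Z f = 1 := fun h' => h ((hX.2 Z hZ).1 h')
      have h0 : ∀ f, X f * Z f = 0 := fun f => by
        have h2 : X f * Z f ≠ -1 := fun h' => h ⟨f, h'⟩
        have h3 : X f * Z f ≠ 1 := fun h' => h1 ⟨f, h'⟩
        generalize X f * Z f = x at *
        clear h h1 he; revert x; decide
      have hc : ∀ f, X.comp Y f * Z f = Y f * Z f := fun f => by
        by_cases hf : X f = 0
        · simp [comp, hf]
        · have : Z f = 0 := (mul_eq_zero.1 (h0 f)).resolve_left hf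
          simp [this]
      simp only [hc] at he ⊢
      exact (hY.2 Z hZ).1 ⟨e, he⟩

/-- Compositions reduce the claim to one element `f` at a time. Farkas' lemma applies with the
separation set minus `e` free for the vector; `e` itself is excluded from it, which forces the value
`0` there. The covector alternative has no product `-1` with `X` or `Y` off `e`, and opposite
products with them at `e`, so orthogonality to both fails. -/
theorem elim_vectors {M : OrientedMatroid α} {X Y : SignedSet α} (hX : X ∈ M.vectors)
    (hY : Y ∈ M.vectors) {e : α} (he : e ∈ X.sep Y) :
    ∃ Z ∈ M.vectors, Z e = 0 ∧ ∀ f ∉ X.sep Y, Z f = X.comp Y f := by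
  classical
  let S : Set (SignedSet α) := {Z | Z ∈ M.vectors ∧ Z e = 0 ∧
    ∀ f ∉ X.sep Y, Z f = 0 ∨ Z f = X.comp Y f}
  have h0S : (0 : SignedSet α) ∈ S :=
    ⟨mem_vectors_iff.2 ⟨fun e he => absurd rfl he, fun _ _ _ h => by simp at h⟩, rfl,
      fun _ _ => Or.inl rfl⟩
  have key : ∀ f ∈ M.ground.filter (· ∉ X.sep Y), ∃ Z ∈ S, Z f = X.comp Y f := by
    intro f hf
    have hfs := (Finset.mem_filter.1 hf).2
    by_cases hf0 : X.comp Y f = 0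
    · exact ⟨0, h0S, hf0.symm⟩
    let σ : SignedSet α := fun g => if g ∈ X.sep Y then 0 else X.comp Y g
    have hσf : σ f = X.comp Y f := if_neg hfs
    rcases M.farkas (σ := σ) (M.ground.filter fun g => g ∈ X.sep Y ∧ g ≠ e) (e := f)
      (fun g hg => (comp_mem_vectors hX hY).1 (fun h => hg (by simp [σ, h])))
      (fun g hg => if_pos (Finset.mem_filter.1 hg).2.1) (by rwa [hσf]) with
      ⟨D, hD, hDf, hDσ, hDB⟩ | ⟨Z, hZ, hZf, hZσ⟩
    · exfalso
      have hDB' : ∀ g ∈ X.sep Y, g ≠ e → D g = 0 := fun g hg hge =>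
        hDB g (Finset.mem_filter.2 ⟨hX.1 hg.1, hg, hge⟩)
      -- off `e`, the covector `D` conforms with both `X` and `Y`
      have hconf : ∀ g, g ≠ e → X g * D g ≠ -1 ∧ Y g * D g ≠ -1 := by
        intro g hge
        by_cases hg : g ∈ X.sep Y
        · simp [hDB' g hg hge]
        · have h1 := hDσ g
          simp only [σ, if_neg hg, comp] at h1
          simp only [sep, Set.mem_ofPred_eq] at hg
          generalize X g = x at *; generalize Y g = y at *; generalize D g = z at *
          clear hDσ hDB' hDB hDf; revert x y z; decide
      have hXe := he.1
      have hYe := he.2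
      have hor : (∃ g, X g * D g = 1) ∨ ∃ g, Y g * D g = 1 := by
        rw [hσf] at hDf
        by_cases h : X f = 0
        · right; refine ⟨f, ?_⟩
          simp only [comp, h, if_true] at hDf hf0
          rw [hDf]; generalize Y f = y at *; clear hDf; revert y; decide
        · left; refine ⟨f, ?_⟩
          simp only [comp, h, if_false] at hDf hf0
          rw [hDf]; generalize X f = y at *; clear hDf; revert y; decide
      have hsame : ∀ {Z W : SignedSet α}, Z ∈ M.vectors → W ∈ M.vectors → W e = -Z e →
          (∀ g, g ≠ e → Z g * D g ≠ -1) → (∀ g, g ≠ e → W g * D g ≠ -1) →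
          ¬ ∃ g, Z g * D g = 1 := by
        intro Z W hZ hW hWe h1 h2 h3
        obtain ⟨g, hg⟩ := (hZ.2 D hD).1 h3
        have hge : g = e := by by_contra h; exact h1 g h hg
        obtain ⟨k, hk⟩ := (hW.2 D hD).1 ⟨e, by rw [hWe, neg_mul, ← hge, hg]; rfl⟩
        have hke : k = e := by by_contra h; exact h2 k h hk
        rw [hge] at hg
        rw [hke, hWe, neg_mul, hg] at hk
        exact absurd hk (by decide)
      rcases hor with h | h
      · exact hsame hX hY hYe (fun g hg => (hconf g hg).1) (fun g hg => (hconf g hg).2) h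
      · exact hsame hY hX (by rw [hYe, neg_neg]) (fun g hg => (hconf g hg).2)
          (fun g hg => (hconf g hg).1) h
    · refine ⟨Z, ⟨hZ, ?_, fun g hg => ?_⟩, by rw [hZf, hσf]⟩
      · have h1 := hZσ e (by simp)
        have h2 : σ e = 0 := if_pos he
        simpa [h2] using h1
      · have h1 := hZσ g (by simp [hg])
        simpa [σ, hg] using h1
  obtain ⟨Z, hZ, hZf⟩ := exists_forall_eq_of_comp_mem (S := S) (σ := X.comp Y) h0S
    (fun Z hZ W hW => ⟨comp_mem_vectors hZ.1 hW.1, by simp [comp, hZ.2.1, hW.2.1], fun f hf => by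
      by_cases h : Z f = 0
      · simpa [comp, h] using hW.2.2 f hf
      · simpa [comp, h] using hZ.2.2 f hf⟩)
    (M.ground.filter (· ∉ X.sep Y)) (fun Z hZ f hf => hZ.2.2 f (Finset.mem_filter.1 hf).2) key
  refine ⟨Z, hZ.1, hZ.2.1, fun f hf => ?_⟩
  by_cases hfg : f ∈ M.ground
  · exact hZf f (Finset.mem_filter.2 ⟨hfg, hf⟩)
  · rw [apply_eq_zero_of_notMem hZ.1.1 hfg,
      apply_eq_zero_of_notMem (comp_mem_vectors hX hY).1 hfg]

/-- The dual oriented matroid, whose covectors are the vectors of `M`. -/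
def dual (M : OrientedMatroid α) : OrientedMatroid α where
  ground := M.ground
  covectors := M.vectors
  supp_subset _ hX := hX.1
  zero_mem := mem_vectors_iff.2 ⟨fun _ he => absurd rfl he, fun _ _ _ h => by simp at h⟩
  neg_mem X hX := by
    refine mem_vectors_iff.2 ⟨by rw [supp_neg]; exact hX.1, fun Y hY e he => ?_⟩
    obtain ⟨f, hf⟩ := (hX.2 Y hY).2 ⟨e, by
      rw [Pi.neg_apply, neg_mul] at he
      exact neg_eq_iff_eq_neg.1 he⟩
    exact ⟨f, by simp [hf]⟩
  comp_mem _ hX _ hY := comp_mem_vectors hX hY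
  elim _ hX _ hY _ he := elim_vectors hX hY he

/-- Farkas' lemma is applied with `σ = Y`. A vector conforming with `Y` on its support would violate
orthogonality, so each element of the support lies in a covector conforming with `Y`; these compose
to `Y`. -/
theorem dual_dual (M : OrientedMatroid α) : M.dual.dual = M := by
  classical
  refine ext_covectors rfl fun Y => ⟨fun hY => ?_, fun hY =>
    ⟨M.supp_subset Y hY, fun X hX => (hX.2 Y hY).symm⟩⟩
  replace hY : Y ∈ M.dual.vectors := hY
  have key : ∀ e ∈ M.ground, ∃ Z ∈ {Z | Z ∈ M.covectors ∧ ∀ f, Z f = 0 ∨ Z f = Y f},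
      Z e = Y e := by
    intro e _
    by_cases he : Y e = 0
    · exact ⟨0, ⟨M.zero_mem, fun _ => Or.inl rfl⟩, he.symm⟩
    rcases M.farkas (σ := Y) (M.ground.filter fun g => Y g = 0) hY.1
      (fun f hf => (Finset.mem_filter.1 hf).2) he with ⟨Z, hZ, hZe, hZY, hZB⟩ | ⟨X, hX, hXe, hXY⟩
    · refine ⟨Z, ⟨hZ, fun f => ?_⟩, hZe⟩
      by_cases hf : Y f = 0
      · left
        by_cases hfg : f ∈ M.ground
        · exact hZB f (Finset.mem_filter.2 ⟨hfg, hf⟩)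
        · exact apply_eq_zero_of_notMem (M.supp_subset Z hZ) hfg
      · exact hZY f hf
    · exfalso
      obtain ⟨f, hf⟩ := (hY.2 X hX).1 ⟨e, by
        rw [hXe]; generalize Y e = y at *; clear hXe; revert y; decide⟩
      have h1 := hXY f (fun h => by simp [(Finset.mem_filter.1 h).2] at hf)
      generalize X f = x at *; generalize Y f = y at *
      revert h1 hf; revert x y; decide
  obtain ⟨Z, hZ, hZY⟩ := exists_forall_eq_of_comp_mem
    (S := {Z | Z ∈ M.covectors ∧ ∀ f, Z f = 0 ∨ Z f = Y f}) (σ := Y)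
    ⟨M.zero_mem, fun _ => Or.inl rfl⟩
    (fun Z hZ W hW => ⟨M.comp_mem Z hZ.1 W hW.1, fun f => by
      by_cases h : Z f = 0
      · simpa [comp, h] using hW.2 f
      · simpa [comp, h] using hZ.2 f⟩)
    M.ground (fun Z hZ e _ => hZ.2 e) key
  have : Y = Z := by
    funext e
    by_cases he : e ∈ M.ground
    · exact (hZY e he).symm
    · rw [apply_eq_zero_of_notMem hY.1 he, apply_eq_zero_of_notMem (M.supp_subset Z hZ.1) he]
  exact this ▸ hZ.1

theorem mem_dual_vectors {M : OrientedMatroid α} {Y : SignedSet α} :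
    Y ∈ M.dual.vectors ↔ Y ∈ M.covectors := by
  conv_rhs => rw [← M.dual_dual]
  rfl

theorem dual_isCircuit {M : OrientedMatroid α} {X : SignedSet α} :
    M.dual.IsCircuit X ↔ M.IsCocircuit X := by
  conv_rhs => rw [← M.dual_dual]
  rfl

theorem dual_isPosCocircuit {M : OrientedMatroid α} {X : SignedSet α} :
    M.dual.IsPosCocircuit X ↔ M.IsPosCircuit X := Iff.rfl

theorem dual_isPosCircuit {M : OrientedMatroid α} {X : SignedSet α} :
    M.dual.IsPosCircuit X ↔ M.IsPosCocircuit X := and_congr_left fun _ => dual_isCircuit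

/-- Every element of a covector lies in a cocircuit conforming to the covector. -/
theorem exists_cocircuit_le {M : OrientedMatroid α} {X : SignedSet α} (hX : X ∈ M.covectors)
    {e : α} (he : X e ≠ 0) :
    ∃ D, M.IsCocircuit D ∧ D e = X e ∧ ∀ f, D f = 0 ∨ D f = X f := by
  classical
  have hfin : ∀ {Z : SignedSet α}, Z ∈ M.covectors → Z.supp.Finite := fun hZ =>
    M.ground.finite_toSet.subset (M.supp_subset _ hZ)
  obtain ⟨Y, ⟨hY, hYe, hYX⟩, hmin⟩ := exists_minimalFor_of_wellFoundedLT
    (fun Y : SignedSet α => Y ∈ M.covectors ∧ Y e = X e ∧ ∀ f, Y f = 0 ∨ Y f = X f)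
    (fun Y => Y.supp.ncard) ⟨X, hX, rfl, fun _ => Or.inr rfl⟩
  have hYe0 : Y e ≠ 0 := hYe ▸ he
  refine ⟨Y, ⟨hY, ne_zero_of_apply hYe0, fun W hW hW0 hWY => ?_⟩, hYe, hYX⟩
  by_contra hne
  have hss : W.supp ⊂ Y.supp := hWY.ssubset_of_ne hne
  -- `Y` has minimal support among the conforming covectors through `e`. From a covector of smaller
  -- support, `hgood` makes one that also has the right sign at `e`, eliminating against `Y` when `W
  -- e = 0`. The sign of `W` can be chosen so that the hypotheses hold.
  have hgood : ∀ W ∈ M.covectors, W.supp ⊂ Y.supp → W e ≠ -Y e → (W e = 0 → (Y.sep W).Nonempty) →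
      ∃ Z ∈ M.covectors, Z.supp ⊂ Y.supp ∧ Z e = Y e := by
    intro W hW hWY hWe hsep
    by_cases h0 : W e = 0
    · obtain ⟨g, hg⟩ := hsep h0
      obtain ⟨Z, hZ, hZg, hZf⟩ := M.elim Y hY W hW g hg
      have hZe : Z e = Y e := by
        rw [hZf e (fun h => hWe h.2)]
        simp [comp, hYe0]
      refine ⟨Z, hZ, ⟨fun f hf => ?_, fun h => h hg.1 hZg⟩, hZe⟩
      by_contra hf0
      have hf0' : Y f = 0 := not_not.1 hf0
      refine hf ?_
      rw [hZf f (fun h => hf0 h.1)]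
      have : W f = 0 := by by_contra h; exact hf0 (hWY.1 h)
      simp [comp, this, hf0']
    · refine ⟨W, hW, hWY, ?_⟩
      generalize W e = x at *; generalize Y e = y at *
      revert h0 hWe hYe0; clear hYe hsep; revert x y; decide
  have hex : ∃ Z ∈ M.covectors, Z.supp ⊂ Y.supp ∧ Z e = Y e := by
    obtain ⟨g, hg⟩ := exists_apply_ne_zero hW0
    have hYg : Y g ≠ 0 := hWY hg
    by_cases h : W e = -Y e ∨ (W e = 0 ∧ W g = Y g)
    · refine hgood (-W) (M.neg_mem W hW) (by rwa [supp_neg]) ?_ fun h0 => ⟨g, hYg, ?_⟩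
      · simp only [Pi.neg_apply]
        have h' : W e = -Y e ∨ W e = 0 := h.imp_right And.left
        revert h' hYe0
        generalize W e = x; generalize Y e = y
        revert x y; decide
      · rcases h with h | h
        · simp only [Pi.neg_apply, h, neg_neg] at h0
          exact absurd h0 hYe0
        · simp [h.2]
    · push Not at h
      refine hgood W hW hss h.1 fun h0 => ⟨g, hYg, ?_⟩
      have h1 := h.2 h0
      revert h1 hg hYg
      generalize W g = x; generalize Y g = y
      revert x y; decide
  -- With the fewest disagreements with `Y`, `Z` has none: eliminating at a disagreement would leave
  -- fewer. So `Z` conforms with `Y`, against the minimality of `Y`.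
  obtain ⟨Z, ⟨hZ, hZY, hZe⟩, hZmin⟩ := exists_minimalFor_of_wellFoundedLT
    (fun Z : SignedSet α => Z ∈ M.covectors ∧ Z.supp ⊂ Y.supp ∧ Z e = Y e)
    (fun Z => (Y.sep Z).ncard) hex
  have hsepfin : (Y.sep Z).Finite := (hfin hY).subset fun f hf => hf.1
  by_cases hsep : (Y.sep Z).Nonempty
  · obtain ⟨g, hg⟩ := hsep
    obtain ⟨U, hU, hUg, hUf⟩ := M.elim Y hY Z hZ g hg
    have hUY : ∀ f ∉ Y.sep Z, U f = Y f := fun f hf => by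
      rw [hUf f hf]
      by_cases h : Y f = 0
      · have : Z f = 0 := by by_contra h'; exact hZY.1 h' h
        simp [comp, h, this]
      · simp [comp, h]
    have hUe : U e = Y e := hUY e fun h => by
      have h1 := h.2
      rw [hZe] at h1
      revert h1 hYe0
      generalize Y e = y
      revert y; decide
    have hsub : Y.sep U ⊂ Y.sep Z := by
      refine ⟨fun f hf => ?_, fun h => ?_⟩
      · by_contra h
        have h1 := hf.2
        have h2 := hf.1
        rw [hUY f h] at h1
        generalize Y f = y at *
        revert h1 h2; revert y; decide
      · have h1 := (h hg).2
        rw [hUg] at h1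
        exact hg.1 (by simpa using h1.symm)
    have hlt := Set.ncard_lt_ncard hsub hsepfin
    have := hZmin ⟨hU, ⟨fun f hf => ?_, fun h => h hg.1 hUg⟩, hUe⟩ hlt.le
    · exact absurd this (not_le.2 hlt)
    · by_cases h : f ∈ Y.sep Z
      · exact h.1
      · exact fun h0 => hf ((hUY f h).trans h0)
  · have hZY' : ∀ f, Z f = 0 ∨ Z f = Y f := fun f => by
      by_contra! h
      refine hsep ⟨f, hZY.1 h.1, ?_⟩
      have h0 : Y f ≠ 0 := hZY.1 h.1
      generalize Z f = x at *; generalize Y f = y at *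
      revert h h0; revert x y; decide
    have hlt := Set.ncard_lt_ncard hZY (hfin hY)
    refine absurd (hmin ⟨hZ, hZe.trans hYe, fun f => ?_⟩ hlt.le) (not_le.2 hlt)
    rcases hZY' f with h | h
    · exact Or.inl h
    · exact h ▸ hYX f

theorem exists_circuit_le {M : OrientedMatroid α} {X : SignedSet α} (hX : X ∈ M.vectors)
    {e : α} (he : X e ≠ 0) :
    ∃ C, M.IsCircuit C ∧ C e = X e ∧ ∀ f, C f = 0 ∨ C f = X f :=
  exists_cocircuit_le (M := M.dual) hX he

end OrientedMatroid

/-! ### Positive vectors and covectors, and acyclicity. -/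

namespace OrientedMatroid

open SignedSet

variable {α : Type*}

theorem isPositive_comp {X Y : SignedSet α} (hX : X.IsPositive) (hY : Y.IsPositive) :
    (X.comp Y).IsPositive := by
  rw [isPositive_iff] at *
  intro e
  by_cases h : X e = 0
  · simpa [comp, h] using hY e
  · simpa [comp, h] using hX e

theorem comp_apply_ne_zero {X Y : SignedSet α} {e : α} :
    X.comp Y e ≠ 0 ↔ X e ≠ 0 ∨ Y e ≠ 0 := by
  by_cases h : X e = 0 <;> simp [comp, h]

theorem exists_posCocircuit_subset {M : OrientedMatroid α} {X : SignedSet α}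
    (hX : X ∈ M.covectors) (hpos : X.IsPositive) {e : α} (he : X e ≠ 0) :
    ∃ D, M.IsPosCocircuit D ∧ e ∈ D.supp ∧ D.supp ⊆ X.supp := by
  obtain ⟨D, hD, hDe, hDX⟩ := exists_cocircuit_le hX he
  rw [isPositive_iff] at hpos
  refine ⟨D, ⟨hD, isPositive_iff.2 fun f => ?_⟩, by rwa [mem_supp, hDe], fun f hf => ?_⟩
  · rcases hDX f with h | h
    · exact Or.inl h
    · exact h ▸ hpos f
  · rwa [mem_supp, ← (hDX f).resolve_left hf]

theorem exists_posCircuit_subset {M : OrientedMatroid α} {X : SignedSet α}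
    (hX : X ∈ M.vectors) (hpos : X.IsPositive) {e : α} (he : X e ≠ 0) :
    ∃ C, M.IsPosCircuit C ∧ e ∈ C.supp ∧ C.supp ⊆ X.supp :=
  exists_posCocircuit_subset (M := M.dual) hX hpos he

theorem eq_zero_or_eq_zero_of_isPositive {M : OrientedMatroid α} {X Y : SignedSet α}
    (hX : X ∈ M.vectors) (hY : Y ∈ M.covectors) (hXpos : X.IsPositive) (hYpos : Y.IsPositive)
    (e : α) : X e = 0 ∨ Y e = 0 := by
  rw [isPositive_iff] at hXpos hYpos
  by_contra! h
  obtain ⟨f, hf⟩ := (hX.2 Y hY).1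
    ⟨e, by rw [(hXpos e).resolve_left h.1, (hYpos e).resolve_left h.2]; rfl⟩
  rcases hXpos f with h1 | h1 <;> rcases hYpos f with h2 | h2 <;> rw [h1, h2] at hf <;>
    exact absurd hf (by decide)

/-- Every element lies in a positive cocircuit or in a positive circuit. -/
theorem exists_posCocircuit_or_posCircuit (M : OrientedMatroid α) {e : α} (he : e ∈ M.ground) :
    (∃ D, M.IsPosCocircuit D ∧ e ∈ D.supp) ∨ ∃ C, M.IsPosCircuit C ∧ e ∈ C.supp := by
  classical
  have hσ : ∀ f, (if f ∈ M.ground then (1 : SignType) else 0) ≠ 0 ↔ f ∈ M.ground := by simp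
  rcases M.exists_covector_or_vector_of_conform (σ := fun f => if f ∈ M.ground then 1 else 0)
    (fun f hf => (hσ f).1 hf) ((hσ e).2 he) with ⟨Y, hY, hYe, hYf⟩ | ⟨X, hX, hXe, hXf⟩
  · left
    have hpos : Y.IsPositive := isPositive_iff.2 fun f => by
      by_cases hf : f ∈ M.ground
      · simpa [hf] using hYf f
      · exact Or.inl (apply_eq_zero_of_notMem (M.supp_subset Y hY) hf)
    obtain ⟨D, hD, hDe, -⟩ := exists_posCocircuit_subset hY hpos (e := e) (by simp [hYe, he])
    exact ⟨D, hD, hDe⟩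
  · right
    have hpos : X.IsPositive := isPositive_iff.2 fun f => by
      by_cases hf : f ∈ M.ground
      · simpa [hf] using hXf f
      · exact Or.inl (apply_eq_zero_of_notMem hX.1 hf)
    obtain ⟨C, hC, hCe, -⟩ := exists_posCircuit_subset hX hpos (e := e) (by simp [hXe, he])
    exact ⟨C, hC, hCe⟩

/-- Positive covectors covering a finite set can be merged into one. -/
theorem exists_isPositive_covector_of_forall {M : OrientedMatroid α} (T : Finset α) (U : Set α)
    (h : ∀ e ∈ T, ∃ X ∈ M.covectors, X.IsPositive ∧ X.supp ⊆ U ∧ e ∈ X.supp) :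
    ∃ X ∈ M.covectors, X.IsPositive ∧ X.supp ⊆ U ∧ ↑T ⊆ X.supp := by
  obtain ⟨X, ⟨hX, hXpos, hXU⟩, hXT⟩ := exists_forall_eq_of_comp_mem
    (S := {X | X ∈ M.covectors ∧ X.IsPositive ∧ X.supp ⊆ U}) (σ := 1)
    ⟨M.zero_mem, isPositive_iff.2 fun _ => Or.inl rfl, fun _ he => absurd rfl he⟩
    (fun X hX Y hY => ⟨M.comp_mem X hX.1 Y hY.1, isPositive_comp hX.2.1 hY.2.1, fun e he =>
      (comp_apply_ne_zero.1 he).elim (fun h => hX.2.2 h) (fun h => hY.2.2 h)⟩)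
    T (fun X hX e _ => isPositive_iff.1 hX.2.1 e)
    (fun e he => by
      obtain ⟨X, hX, hXpos, hXU, hXe⟩ := h e he
      exact ⟨X, ⟨hX, hXpos, hXU⟩, hXpos e hXe⟩)
  exact ⟨X, hX, hXpos, hXU, fun e he => by rw [mem_supp, hXT e he, Pi.one_apply]; decide⟩

theorem IsAcyclic.exists_isPositive_covector {M : OrientedMatroid α} (h : M.IsAcyclic) :
    ∃ X ∈ M.covectors, X.IsPositive ∧ X.supp = M.ground := by
  obtain ⟨X, hX, hpos, hXU, hXT⟩ := exists_isPositive_covector_of_forall (M := M) M.ground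
    M.ground fun e he => by
      rcases M.exists_posCocircuit_or_posCircuit he with ⟨D, hD, hDe⟩ | ⟨C, hC, -⟩
      · exact ⟨D, hD.1.1, hD.2, M.supp_subset D hD.1.1, hDe⟩
      · exact absurd hC (h C)
  exact ⟨X, hX, hpos, hXU.antisymm hXT⟩

theorem IsAcyclic.of_covector {M : OrientedMatroid α} {X : SignedSet α} (hX : X ∈ M.covectors)
    (hpos : X.IsPositive) (hs : ↑M.ground ⊆ X.supp) : M.IsAcyclic := by
  intro C hC
  obtain ⟨e, he⟩ := exists_apply_ne_zero hC.1.2.1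
  rcases eq_zero_or_eq_zero_of_isPositive hC.1.1 hX hC.2 hpos e with h | h
  · exact he h
  · exact hs (hC.1.1.1 he) h

theorem isTotallyCyclic_iff_dual {M : OrientedMatroid α} :
    M.IsTotallyCyclic ↔ M.dual.IsAcyclic := by
  refine ⟨fun h D hD => ?_, fun h e he => ?_⟩
  · rw [dual_isPosCircuit] at hD
    obtain ⟨e, he⟩ := exists_apply_ne_zero hD.1.2.1
    obtain ⟨C, hC, hCe⟩ := h e (M.supp_subset D hD.1.1 he)
    exact (eq_zero_or_eq_zero_of_isPositive hC.1.1 hD.1.1 hC.2 hD.2 e).elim hCe he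
  · rcases M.exists_posCocircuit_or_posCircuit he with ⟨D, hD, -⟩ | h'
    · exact absurd (dual_isPosCircuit.2 hD) (h D)
    · exact h'

theorem isDualBoundedAt_iff_dual {M : OrientedMatroid α} {p : α} :
    M.IsDualBoundedAt p ↔ M.dual.IsBoundedAt p := by
  simp only [IsDualBoundedAt, IsBoundedAt, isTotallyCyclic_iff_dual, dual_isPosCocircuit]
  rfl

/-! ### Minors and their duals. -/

section Minor

variable [DecidableEq α]

theorem minor_ground {M : OrientedMatroid α} {G F : Finset α} (hG : G ⊆ M.ground) :
    (M.minor G F).ground = G \ F := by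
  simp [minor, contract, restrict, Finset.inter_eq_right.2 hG]

theorem mem_minor_covectors {M : OrientedMatroid α} {G F : Finset α} (hFG : F ⊆ G)
    {X : SignedSet α} : X ∈ (M.minor G F).covectors ↔
      ∃ Y ∈ M.covectors, (∀ e ∈ F, Y e = 0) ∧ restr G Y = X := by
  constructor
  · rintro ⟨⟨Y, hY, rfl⟩, h⟩
    exact ⟨Y, hY, fun e he => by simpa [restr, hFG he] using h e he, rfl⟩
  · rintro ⟨Y, hY, h, rfl⟩
    exact ⟨⟨Y, hY, rfl⟩, fun e he => by simp [restr, h e he]⟩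

theorem mem_restrict_vectors {M : OrientedMatroid α} {G : Finset α} {X : SignedSet α} :
    X ∈ (M.restrict G).vectors ↔ X ∈ M.vectors ∧ X.supp ⊆ G := by
  have hor : X.supp ⊆ G → ∀ Y, X.Orth (restr G Y) ↔ X.Orth Y := fun h Y =>
    orth_congr fun e => by
      by_cases he : e ∈ G
      · simp [restr, he]
      · have : X e = 0 := by by_contra h'; exact he (h h')
        simp [this]
  constructor
  · rintro ⟨hs, hX⟩
    have h2 : X.supp ⊆ G := fun e he => (Finset.mem_inter.1 (hs he)).2
    exact ⟨⟨fun e he => (Finset.mem_inter.1 (hs he)).1, fun Y hY =>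
      (hor h2 Y).1 (hX _ ⟨Y, hY, rfl⟩)⟩, h2⟩
  · rintro ⟨⟨hs, hX⟩, h2⟩
    refine ⟨fun e he => Finset.mem_inter.2 ⟨hs he, h2 he⟩, ?_⟩
    rintro _ ⟨Y, hY, rfl⟩
    exact (hor h2 Y).2 (hX Y hY)

/-- One inclusion is the lifting of vectors through the contraction of `F`. For the other, a vector
vanishing off `G` and a covector vanishing on `F` have all their nonzero products on `G \ F`, so
truncation preserves orthogonality. -/
theorem minor_dual {M : OrientedMatroid α} {G F : Finset α} (hFG : F ⊆ G) (hG : G ⊆ M.ground) :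
    (M.minor G F).dual = M.dual.minor (M.ground \ F) (M.ground \ G) := by
  refine ext_covectors ?_ fun X => ?_
  · rw [minor_ground (M := M.dual) (G := M.ground \ F) Finset.sdiff_subset]
    change (M.minor G F).ground = _
    rw [minor_ground hG]
    ext e
    simp only [Finset.mem_sdiff]
    exact ⟨fun h => ⟨⟨hG h.1, h.2⟩, fun h' => h'.2 h.1⟩, fun h =>
      ⟨by by_contra h'; exact h.2 ⟨h.1.1, h'⟩, h.1.2⟩⟩
  rw [mem_minor_covectors (Finset.sdiff_subset_sdiff le_rfl hFG)]
  constructor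
  · intro hX
    obtain ⟨X', hX', h⟩ := exists_vector_of_contract (M := M.restrict G) F hX
    rw [mem_restrict_vectors] at hX'
    refine ⟨X', hX'.1, fun e he => ?_, funext fun e => ?_⟩
    · by_contra h'
      exact (Finset.mem_sdiff.1 he).2 (hX'.2 h')
    · have hXs : ∀ e, X e ≠ 0 → e ∈ G \ F := fun e he =>
        minor_ground hG ▸ Finset.mem_coe.1 (hX.1 he)
      simp only [restr, Finset.mem_sdiff]
      split_ifs with he
      · exact h e he.2
      · by_contra h'
        have := Finset.mem_sdiff.1 (hXs e (Ne.symm h'))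
        exact he ⟨hG this.1, this.2⟩
  · rintro ⟨Y, hY, hYG, rfl⟩
    replace hY : Y ∈ M.vectors := hY
    have hYG' : ∀ e ∉ G, Y e = 0 := fun e he => by
      by_cases heM : e ∈ M.ground
      · exact hYG e (Finset.mem_sdiff.2 ⟨heM, he⟩)
      · exact apply_eq_zero_of_notMem hY.1 heM
    refine ⟨fun e he => ?_, fun Z hZ => ?_⟩
    · rw [minor_ground hG]
      simp only [supp, restr, Set.mem_ofPred_eq, Finset.mem_sdiff, ne_eq, ite_eq_right_iff,
        Classical.not_imp] at he
      simp only [Finset.coe_sdiff, Set.mem_sdiff, Finset.mem_coe]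
      refine ⟨?_, he.1.2⟩
      by_contra h
      exact he.2 (hYG' e h)
    · rw [mem_minor_covectors hFG] at hZ
      obtain ⟨W, hW, hWF, rfl⟩ := hZ
      refine (orth_congr fun e => ?_).1 (hY.2 W hW)
      by_cases heF : e ∈ F
      · simp [restr, hWF e heF]
      by_cases heG : e ∈ G
      · simp [restr, heF, heG, hG heG]
      · simp [restr, hYG' e heG]

end Minor

/-! ### Bounded oriented matroids are connected. -/

section Connected

/-- Two elements are linked if they are equal or lie in a common circuit. -/
def Linked (M : OrientedMatroid α) (e f : α) : Prop :=
  e = f ∨ ∃ C, M.IsCircuit C ∧ e ∈ C.supp ∧ f ∈ C.supp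

theorem Linked.symm {M : OrientedMatroid α} {e f : α} (h : M.Linked e f) : M.Linked f e := by
  rcases h with rfl | ⟨C, hC, he, hf⟩
  · exact Or.inl rfl
  · exact Or.inr ⟨C, hC, hf, he⟩

/-- Strong circuit elimination for the underlying matroid. -/
theorem IsCircuit.exists_elim {M : OrientedMatroid α} {C D : SignedSet α} (hC : M.IsCircuit C)
    (hD : M.IsCircuit D) {e f : α} (hfC : f ∈ C.supp) (hfD : f ∈ D.supp) (heC : e ∈ C.supp)
    (heD : e ∉ D.supp) :
    ∃ K, M.IsCircuit K ∧ e ∈ K.supp ∧ f ∉ K.supp ∧ K.supp ⊆ C.supp ∪ D.supp := by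
  obtain ⟨D', hD', hfD', hs⟩ : ∃ D' ∈ M.vectors, f ∈ C.sep D' ∧ D'.supp = D.supp := by
    by_cases h : D f = -C f
    · exact ⟨D, hD.1, ⟨hfC, h⟩, rfl⟩
    · refine ⟨-D, M.dual.neg_mem D hD.1, ⟨hfC, ?_⟩, supp_neg D⟩
      simp only [mem_supp] at hfC hfD
      simp only [Pi.neg_apply]
      revert h hfC hfD
      generalize C f = x; generalize D f = y
      revert x y; decide
  have heD' : D' e = 0 := by
    by_contra h
    exact heD (hs ▸ h)
  obtain ⟨Z, hZ, hZf, hZg⟩ := elim_vectors hC.1 hD' hfD'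
  have hZe : Z e ≠ 0 := by
    rw [hZg e (fun h => h.1 (by simpa [heD'] using h.2.symm))]
    exact comp_apply_ne_zero.2 (Or.inl heC)
  obtain ⟨K, hK, hKe, hKZ⟩ := exists_circuit_le hZ hZe
  have hKs : K.supp ⊆ Z.supp := fun g hg => by rwa [mem_supp, ← (hKZ g).resolve_left hg]
  refine ⟨K, hK, by rwa [mem_supp, hKe], fun h => hKs h hZf, fun g hg => ?_⟩
  by_cases h : g ∈ C.sep D'
  · exact Or.inl h.1
  · have h1 : Z g ≠ 0 := hKs hg
    rw [hZg g h] at h1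
    exact (comp_apply_ne_zero.1 h1).imp id fun h => hs ▸ h

/-- Choose a counterexample with smallest union, and `f` in both circuits. Strong elimination gives
`K` through `e` and `L` through `g`, both avoiding `f`. `K` meets `D` outside `C`, and minimality
for the pair `(C, L)` puts that point in `L`; so `(K, L)` is a pair with smaller union, missing `f`.
-/
theorem IsCircuit.exists_common {M : OrientedMatroid α} {C D : SignedSet α} (hC : M.IsCircuit C)
    (hD : M.IsCircuit D) {e g : α} (hCD : (C.supp ∩ D.supp).Nonempty) (he : e ∈ C.supp)
    (hg : g ∈ D.supp) : ∃ K, M.IsCircuit K ∧ e ∈ K.supp ∧ g ∈ K.supp := by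
  by_contra! hno
  obtain ⟨⟨C, D⟩, ⟨hC, hD, hCD, he, hg⟩, hmin⟩ := exists_minimalFor_of_wellFoundedLT
    (fun P : SignedSet α × SignedSet α => M.IsCircuit P.1 ∧ M.IsCircuit P.2 ∧
      (P.1.supp ∩ P.2.supp).Nonempty ∧ e ∈ P.1.supp ∧ g ∈ P.2.supp)
    (fun P => (P.1.supp ∪ P.2.supp).ncard) ⟨(C, D), hC, hD, hCD, he, hg⟩
  dsimp only at hC hD hCD he hg hmin
  have hfin : (C.supp ∪ D.supp).Finite :=
    M.ground.finite_toSet.subset (Set.union_subset hC.1.1 hD.1.1)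
  have hmin' : ∀ C' D', M.IsCircuit C' → M.IsCircuit D' → (C'.supp ∩ D'.supp).Nonempty →
      e ∈ C'.supp → g ∈ D'.supp → C'.supp ∪ D'.supp ⊆ C.supp ∪ D.supp →
      C.supp ∪ D.supp ⊆ C'.supp ∪ D'.supp := by
    intro C' D' h1 h2 h3 h4 h5 h6
    by_contra h7
    have hlt := Set.ncard_lt_ncard ⟨h6, h7⟩ hfin
    exact absurd (hmin (j := (C', D')) ⟨h1, h2, h3, h4, h5⟩ hlt.le) (not_le.2 hlt)
  obtain ⟨f, hfC, hfD⟩ := hCD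
  have heD : e ∉ D.supp := fun h => hno D hD h hg
  have hgC : g ∉ C.supp := fun h => hno C hC he h
  obtain ⟨K, hK, heK, hfK, hKs⟩ := hC.exists_elim hD hfC hfD he heD
  obtain ⟨L, hL, hgL, hfL, hLs⟩ := hD.exists_elim hC hfD hfC hg hgC
  have hmeet : ∀ {C D K : SignedSet α}, M.IsCircuit C → M.IsCircuit K → f ∈ C.supp →
      f ∉ K.supp → K.supp ⊆ C.supp ∪ D.supp → ∃ x ∈ K.supp, x ∈ D.supp ∧ x ∉ C.supp := by
    intro C D K hC hK hfC hfK hs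
    by_contra! h
    have hsub : K.supp ⊆ C.supp := fun x hx => (hs hx).elim id fun h' => h x hx h'
    exact hfK (hC.2.2 K hK.1 hK.2.1 hsub ▸ hfC)
  obtain ⟨x, hxK, hxD, hxC⟩ := hmeet hC hK hfC hfK hKs
  obtain ⟨y, hyL, hyC, hyD⟩ := hmeet hD hL hfD hfL hLs
  have hxL : x ∈ L.supp := (hmin' C L hC hL ⟨y, hyC, hyL⟩ he hgL
    (Set.union_subset Set.subset_union_left (hLs.trans (Set.union_comm _ _).subset))
    (Or.inr hxD)).resolve_left hxC
  exact (hmin' K L hK hL ⟨x, hxK, hxL⟩ heK hgL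
    (Set.union_subset hKs (hLs.trans (Set.union_comm _ _).subset)) (Or.inl hfC)).elim hfK hfL

theorem Linked.trans {M : OrientedMatroid α} {e f g : α} (h : M.Linked e f) (h' : M.Linked f g) :
    M.Linked e g := by
  rcases h with rfl | ⟨C, hC, he, hf⟩
  · exact h'
  rcases h' with rfl | ⟨D, hD, hf', hg⟩
  · exact Or.inr ⟨C, hC, he, hf⟩
  · exact Or.inr (hC.exists_common hD ⟨f, hf, hf'⟩ he hg)

theorem isConnected_of_forall_linked {M : OrientedMatroid α} {p : α}
    (h : ∀ e ∈ M.ground, M.Linked p e) : M.IsConnected := fun e he f hf hef =>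
  ((h e he).symm.trans (h f hf)).resolve_left hef

theorem IsDualBoundedAt.isConnected {M : OrientedMatroid α} {p : α} (h : M.IsDualBoundedAt p) :
    M.IsConnected :=
  isConnected_of_forall_linked (p := p) fun e he => by
    obtain ⟨C, hC, hCe⟩ := h.2.1 e he
    exact Or.inr ⟨C, hC.1, h.2.2 C hC, hCe⟩

/-- A circuit lies within one class of linked elements, so cutting a covector down to a union of
classes keeps it orthogonal to all vectors. Were some element not linked to `p`, cutting down the
full positive covector would yield a positive cocircuit missing `p`. -/
theorem IsBoundedAt.isConnected {M : OrientedMatroid α} {p : α} (h : M.IsBoundedAt p) :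
    M.IsConnected := by
  classical
  obtain ⟨X, hX, hpos, hXs⟩ := h.2.1.exists_isPositive_covector
  refine isConnected_of_forall_linked (p := p) fun e he => ?_
  by_contra hpe
  -- the restriction of `X` to the elements not linked to `p` is a covector
  have hY : (fun f => if M.Linked p f then 0 else X f) ∈ M.covectors := by
    rw [← mem_dual_vectors, mem_vectors_iff]
    refine ⟨fun f hf => M.supp_subset X hX fun h0 => hf (by simp [h0]), fun V hV f hf => ?_⟩
    have hfl : ¬ M.Linked p f := fun h => by simp [h] at hf
    simp only [hfl, if_false] at hf
    obtain ⟨C, hC, hCf, hCV⟩ := exists_circuit_le (M := M) hV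
      (e := f) (by intro h; simp [h] at hf)
    obtain ⟨g, hg⟩ := (hC.1.2 X hX).1 ⟨f, by rw [hCf, mul_comm, hf]⟩
    have hCg : C g ≠ 0 := by intro h; simp [h] at hg
    have hCf' : C f ≠ 0 := by rw [hCf]; intro h; simp [h] at hf
    have hgl : ¬ M.Linked p g := fun h => hfl (h.trans (Or.inr ⟨C, hC, hCg, hCf'⟩))
    refine ⟨g, ?_⟩
    simp only [hgl, if_false]
    rw [← (hCV g).resolve_left hCg, mul_comm, hg]
  obtain ⟨D, hD, -, hDs⟩ := exists_posCocircuit_subset hY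
    (isPositive_iff.2 fun f => by
      split_ifs
      · exact Or.inl rfl
      · exact isPositive_iff.1 hpos f) (e := e) (by
      simp only [hpe, if_false]
      have : e ∈ X.supp := hXs ▸ he
      exact this)
  exact hDs (h.2.2 D hD) (if_pos (Or.inl rfl))

theorem IsBoundedAt.not_isLoop {M : OrientedMatroid α} {p : α} (h : M.IsBoundedAt p) :
    ¬ M.IsLoop := by
  rintro ⟨e, -, C, hC, hCs⟩
  obtain ⟨X, hX, hpos, hXs⟩ := h.2.1.exists_isPositive_covector
  have h0 : ∀ f, f ≠ e → C f = 0 := fun f hf => by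
    by_contra h'
    exact hf (hCs.subset h')
  have hCe : C e ≠ 0 := by
    have : e ∈ C.supp := hCs ▸ rfl
    exact this
  have hXe : X e = 1 := hpos e (hXs ▸ hC.1.1 hCe)
  have hiff := hC.1.2 X hX
  have : ∀ s : SignType, s ≠ 0 → ((∃ f, C f * X f = s) ↔ C e = s) := fun s hs =>
    ⟨fun ⟨f, hf⟩ => by
      by_cases hfe : f = e
      · simpa [hfe, hXe] using hf
      · rw [h0 f hfe, zero_mul] at hf
        exact absurd hf.symm hs, fun hs => ⟨e, by rw [hXe, hs, mul_one]⟩⟩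
  rw [Orth, this 1 (by decide), this (-1) (by decide)] at hiff
  generalize C e = x at *
  clear this; revert x; decide

theorem isIsthmus_iff_dual {M : OrientedMatroid α} : M.IsIsthmus ↔ M.dual.IsLoop := by
  simp only [IsIsthmus, IsLoop, dual_isCircuit]
  rfl

theorem IsDualBoundedAt.not_isIsthmus {M : OrientedMatroid α} {p : α}
    (h : M.IsDualBoundedAt p) : ¬ M.IsIsthmus := by
  rw [isIsthmus_iff_dual]
  exact (isDualBoundedAt_iff_dual.1 h).not_isLoop

end Connected

end OrientedMatroid

/-! ### Chains with bounded minors, and their uniqueness. -/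

namespace OrientedMatroid

open SignedSet

variable {α : Type*} [LinearOrder α]

/-- An increasing chain of sets ending at the ground set, such that the minima of the successive
differences increase, and the minors it induces are bounded with respect to these minima. -/
structure IsBoundedChain (M : OrientedMatroid α) {n : ℕ} (F : Fin (n + 1) → Finset α) : Prop where
  strictMono : StrictMono F
  last : F (Fin.last n) = M.ground
  min_strictMono : StrictMono fun k : Fin n => (F k.succ \ F k.castSucc).min
  bounded : ∀ k : Fin n, ∃ p : α, (F k.succ \ F k.castSucc).min = p ∧
    (M.minor (F k.succ) (F k.castSucc)).IsBoundedAt p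

/-- The `k`-th set of the increasing part of the active filtration. -/
noncomputable def activeFlat (M : OrientedMatroid α) (k : ℕ) : Finset α :=
  if h : k < M.dualActive.card then
    M.ground \ M.cocircuitUnion (M.dualActive.orderEmbOfFin rfl ⟨k, h⟩)
  else M.ground

section Chain

variable {M : OrientedMatroid α} {n : ℕ} {F : Fin (n + 1) → Finset α}

theorem IsBoundedChain.subset_ground (h : M.IsBoundedChain F) (k : Fin (n + 1)) :
    F k ⊆ M.ground :=
  h.last ▸ h.strictMono.monotone (Fin.le_last k)

theorem IsBoundedChain.castSucc_subset (h : M.IsBoundedChain F) (k : Fin n) :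
    F k.castSucc ⊆ F k.succ :=
  h.strictMono.monotone Fin.castSucc_lt_succ.le

/-- Going down from the top, the covector for the next set is composed with a lift of the full
positive covector of the minor. The lift has unknown signs outside the larger set, and these are
masked by the first factor. -/
theorem IsBoundedChain.exists_isPositive_covector (h : M.IsBoundedChain F) (k : Fin (n + 1)) :
    ∃ X ∈ M.covectors, X.IsPositive ∧ ∀ e, X e ≠ 0 ↔ e ∈ M.ground ∧ e ∉ F k := by
  induction k using Fin.reverseInduction with
  | last =>
    refine ⟨0, M.zero_mem, isPositive_iff.2 fun _ => Or.inl rfl, fun e => ?_⟩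
    simp [h.last]
  | cast k ih =>
    obtain ⟨Y, hY, hYpos, hYs⟩ := ih
    obtain ⟨p, -, hb⟩ := h.bounded k
    obtain ⟨X, hX, hXpos, hXs⟩ := hb.2.1.exists_isPositive_covector
    rw [minor_ground (h.subset_ground _)] at hXs
    obtain ⟨Z, hZ, hZ0, rfl⟩ := (mem_minor_covectors (h.castSucc_subset k)).1 hX
    have hZs : ∀ e ∈ F k.succ, Z e ≠ 0 ↔ e ∉ F k.castSucc := fun e he => by
      have : e ∈ (restr (F k.succ) Z).supp ↔ e ∈ (↑(F k.succ \ F k.castSucc) : Set α) := by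
        rw [hXs]
      simpa [supp, restr, he] using this
    refine ⟨Y.comp Z, M.comp_mem Y hY Z hZ, isPositive_iff.2 fun e => ?_, fun e => ?_⟩
    · by_cases hYe : Y e = 0
      · simp only [comp, hYe, if_true]
        by_cases he : e ∈ F k.succ
        · simpa [restr, he] using isPositive_iff.1 hXpos e
        · by_cases heM : e ∈ M.ground
          · exact absurd hYe ((hYs e).2 ⟨heM, he⟩)
          · exact Or.inl (apply_eq_zero_of_notMem (M.supp_subset Z hZ) heM)
      · simpa [comp, hYe] using isPositive_iff.1 hYpos e
    · rw [comp_apply_ne_zero, hYs]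
      constructor
      · rintro (⟨h1, h2⟩ | h1)
        · exact ⟨h1, fun h3 => h2 (h.castSucc_subset k h3)⟩
        · exact ⟨M.supp_subset Z hZ h1, fun h2 => h1 (hZ0 e h2)⟩
      · rintro ⟨h1, h2⟩
        by_cases he : e ∈ F k.succ
        · exact Or.inr ((hZs e he).2 h2)
        · exact Or.inl ⟨h1, he⟩

theorem IsBoundedChain.exists_mem_part (h : M.IsBoundedChain F) (k : Fin (n + 1)) :
    ∀ e ∈ M.ground, e ∉ F k → ∃ j : Fin n, k ≤ j.castSucc ∧ e ∈ F j.succ \ F j.castSucc := by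
  induction k using Fin.reverseInduction with
  | last => intro e he h'; exact absurd he (h.last ▸ h')
  | cast k ih =>
    intro e he h'
    by_cases hk : e ∈ F k.succ
    · exact ⟨k, le_rfl, Finset.mem_sdiff.2 ⟨hk, h'⟩⟩
    · obtain ⟨j, hj, hje⟩ := ih e he hk
      exact ⟨j, Fin.castSucc_lt_succ.le.trans hj, hje⟩

/-- A chain with bounded minors whose first set meets no positive covector is the increasing part
of the active filtration. -/
theorem IsBoundedChain.eq_activeFlat (h : M.IsBoundedChain F)
    (h0 : ∀ X ∈ M.covectors, X.IsPositive → ∀ e ∈ F 0, X e = 0) :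
    n = M.dualActive.card ∧ ∀ k : Fin (n + 1), F k = M.activeFlat k := by
  classical
  choose p hp hb using h.bounded
  have hpmono : StrictMono p := fun i j hij => by
    have := h.min_strictMono hij
    simp only [hp] at this
    exact WithTop.coe_lt_coe.1 this
  have hpmem : ∀ k, p k ∈ F k.succ \ F k.castSucc := fun k => Finset.mem_of_min (hp k)
  -- Since the minima of the parts increase, `p k` is the minimum of the whole complement of the
  -- `k`-th set, not only of the next part.
  have hple : ∀ k : Fin n, ∀ e ∈ M.ground, e ∉ F k.castSucc → p k ≤ e := by
    intro k e he hek
    obtain ⟨j, hj, hje⟩ := h.exists_mem_part k.castSucc e he hek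
    exact (hpmono.monotone (Fin.castSucc_le_castSucc_iff.1 hj)).trans
      (Finset.min_le_of_eq hje (hp j))
  -- the first minor met by a positive covector
  have hfirst : ∀ X ∈ M.covectors, X.IsPositive → X ≠ 0 →
      ∃ j : Fin n, (∀ e ∈ F j.castSucc, X e = 0) ∧ X (p j) ≠ 0 := by
    intro X hX hpos hX0
    by_contra! hcon
    have hall : ∀ k : Fin (n + 1), ∀ e ∈ F k, X e = 0 := by
      intro k
      induction k using Fin.induction with
      | zero => exact h0 X hX hpos
      | succ k ih =>
        by_contra! hex
        obtain ⟨e, he, hXe⟩ := hex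
        have hmem : restr (F k.succ) X ∈ (M.minor (F k.succ) (F k.castSucc)).covectors :=
          (mem_minor_covectors (h.castSucc_subset k)).2 ⟨X, hX, ih, rfl⟩
        obtain ⟨D, hD, -, hDs⟩ := exists_posCocircuit_subset hmem
          (isPositive_iff.2 fun f => by
            by_cases hf : f ∈ F k.succ
            · simpa [restr, hf] using isPositive_iff.1 hpos f
            · simp [restr, hf]) (e := e) (by simpa [restr, he] using hXe)
        have h1 := hDs ((hb k).2.2 D hD)
        refine h1 ?_
        simp [restr, hcon k ih]
    obtain ⟨e, he⟩ := exists_apply_ne_zero hX0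
    exact he (hall (Fin.last n) e (h.last ▸ M.supp_subset X hX he))
  have hcov : ∀ k : Fin n, ∀ e ∈ M.ground, e ∉ F k.castSucc →
      ∃ D, M.IsPosCocircuit D ∧ (∀ x ∈ D.supp, p k ≤ x) ∧ e ∈ D.supp := by
    intro k e he hek
    obtain ⟨X, hX, hpos, hXs⟩ := h.exists_isPositive_covector k.castSucc
    obtain ⟨D, hD, hDe, hDs⟩ := exists_posCocircuit_subset hX hpos ((hXs e).2 ⟨he, hek⟩)
    refine ⟨D, hD, fun x hx => ?_, hDe⟩
    obtain ⟨h1, h2⟩ := (hXs x).1 (hDs hx)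
    exact hple k x h1 h2
  have hunion : ∀ k : Fin n, M.cocircuitUnion (p k) = M.ground \ F k.castSucc := by
    intro k
    ext e
    simp only [cocircuitUnion, Finset.mem_filter, Finset.mem_sdiff]
    refine and_congr_right fun he => ⟨?_, hcov k e he⟩
    rintro ⟨D, hD, hDp, hDe⟩ hek
    -- `D` contains `p j`, so `p k ≤ p j` and `k ≤ j`; hence `D` vanishes on the `k`-th set.
    obtain ⟨j, hj0, hj⟩ := hfirst D hD.1.1 hD.2 hD.1.2.1
    have hkj : k ≤ j := hpmono.le_iff_le.1 (hDp _ hj)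
    exact hDe (hj0 e (h.strictMono.monotone (Fin.castSucc_le_castSucc_iff.2 hkj) hek))
  have hpg : ∀ k, p k ∈ M.ground ∧ p k ∉ F k.castSucc := fun k =>
    ⟨h.subset_ground _ (Finset.mem_sdiff.1 (hpmem k)).1, (Finset.mem_sdiff.1 (hpmem k)).2⟩
  have hdual : ∀ a, a ∈ M.dualActive ↔ ∃ k, p k = a := by
    intro a
    simp only [dualActive, Finset.mem_filter]
    constructor
    · rintro ⟨ha, D, hD, hDa, hle⟩
      obtain ⟨j, hj0, hj⟩ := hfirst D hD.1.1 hD.2 hD.1.2.1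
      exact ⟨j, (hple j a ha fun h' => hDa (hj0 a h')).antisymm (hle hj)⟩
    · rintro ⟨k, rfl⟩
      obtain ⟨D, hD, hle, hDe⟩ := hcov k (p k) (hpg k).1 (hpg k).2
      exact ⟨(hpg k).1, D, hD, hDe, hle⟩
  have hcard : n = M.dualActive.card := by
    have : M.dualActive = Finset.univ.image p := by
      ext a; simp [hdual]
    rw [this, Finset.card_image_of_injective _ hpmono.injective, Finset.card_fin]
  subst hcard
  have hemb : p = M.dualActive.orderEmbOfFin rfl :=
    Finset.orderEmbOfFin_unique rfl (fun k => (hdual _).2 ⟨k, rfl⟩) hpmono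
  refine ⟨rfl, fun k => ?_⟩
  induction k using Fin.lastCases with
  | last => simp [activeFlat, h.last]
  | cast k =>
    have hk := hunion k
    rw [hemb] at hk
    simp only [activeFlat, Fin.val_castSucc, k.2, dif_pos, Fin.eta, hk,
      Finset.sdiff_sdiff_eq_self (h.subset_ground _)]

end Chain

/-! ### The increasing half of the active filtration has bounded minors. -/

section Active

variable {M : OrientedMatroid α}

theorem activeFlat_subset_ground (k : ℕ) : M.activeFlat k ⊆ M.ground := by
  unfold activeFlat
  split_ifs
  · exact Finset.sdiff_subset
  · exact le_rfl

theorem activeFlat_eq_ground_of_not_lt {k : ℕ} (hk : ¬ k < M.dualActive.card) :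
    M.activeFlat k = M.ground := dif_neg hk

/-- `M.cocircuitUnion a` is also the union of the positive covectors whose support lies
above `a`. -/
theorem mem_cocircuitUnion_iff {a e : α} : e ∈ M.cocircuitUnion a ↔
    ∃ X ∈ M.covectors, X.IsPositive ∧ (∀ x ∈ X.supp, a ≤ x) ∧ e ∈ X.supp := by
  simp only [cocircuitUnion, Finset.mem_filter]
  constructor
  · rintro ⟨-, D, hD, hle, he⟩
    exact ⟨D, hD.1.1, hD.2, hle, he⟩
  · rintro ⟨X, hX, hpos, hle, he⟩
    obtain ⟨D, hD, hDe, hDs⟩ := exists_posCocircuit_subset hX hpos he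
    exact ⟨M.supp_subset X hX he, D, hD, fun x hx => hle x (hDs hx), hDe⟩

theorem cocircuitUnion_subset_ground (a : α) : M.cocircuitUnion a ⊆ M.ground := by
  classical exact Finset.filter_subset _ _

theorem exists_dualActive_le {X : SignedSet α} (hX : X ∈ M.covectors) (hpos : X.IsPositive)
    {e : α} (he : e ∈ X.supp) : ∃ a ∈ M.dualActive, a ∈ X.supp ∧ e ∈ M.cocircuitUnion a := by
  classical
  obtain ⟨D, hD, hDe, hDs⟩ := exists_posCocircuit_subset hX hpos he
  have hDg := M.supp_subset D hD.1.1
  have hfin : D.supp.Finite := M.ground.finite_toSet.subset hDg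
  obtain ⟨a, ha, hle⟩ := Set.exists_min_image D.supp id hfin ⟨e, hDe⟩
  exact ⟨a, Finset.mem_filter.2 ⟨hDg ha, D, hD, ha, fun x hx => hle x hx⟩, hDs ha,
    mem_cocircuitUnion_iff.2 ⟨D, hD.1.1, hD.2, hle, hDe⟩⟩

theorem cocircuitUnion_anti {a b : α} (hab : a ≤ b) :
    M.cocircuitUnion b ⊆ M.cocircuitUnion a := fun e he => by
  rw [mem_cocircuitUnion_iff] at *
  obtain ⟨X, hX, hpos, hle, he⟩ := he
  exact ⟨X, hX, hpos, fun x hx => hab.trans (hle x hx), he⟩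

/-- The complement of a set of the active filtration is the support of a positive covector. -/
theorem exists_covector_compl_activeFlat (k : ℕ) :
    ∃ X ∈ M.covectors, X.IsPositive ∧ ∀ e, X e ≠ 0 ↔ e ∈ M.ground ∧ e ∉ M.activeFlat k := by
  unfold activeFlat
  split_ifs with hk
  · set a := M.dualActive.orderEmbOfFin rfl ⟨k, hk⟩
    obtain ⟨X, hX, hpos, hXU, hXT⟩ := exists_isPositive_covector_of_forall (M := M)
      (M.cocircuitUnion a) {x | a ≤ x} fun e he => mem_cocircuitUnion_iff.1 he
    refine ⟨X, hX, hpos, fun e => ⟨fun he => ?_, fun ⟨h1, h2⟩ => hXT ?_⟩⟩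
    · have : e ∈ M.cocircuitUnion a := mem_cocircuitUnion_iff.2 ⟨X, hX, hpos, hXU, he⟩
      exact ⟨M.supp_subset X hX he, by simp [this]⟩
    · simpa [h1] using h2
  · exact ⟨0, M.zero_mem, isPositive_iff.2 fun _ => Or.inl rfl, fun e => by simp⟩

theorem notMem_activeFlat_iff {k : ℕ} (hk : k < M.dualActive.card) {e : α} (he : e ∈ M.ground) :
    e ∉ M.activeFlat k ↔ e ∈ M.cocircuitUnion (M.dualActive.orderEmbOfFin rfl ⟨k, hk⟩) := by
  simp [activeFlat, hk, he]

theorem isBoundedChain_activeFlat (M : OrientedMatroid α) :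
    M.IsBoundedChain fun k : Fin (M.dualActive.card + 1) => M.activeFlat k := by
  classical
  set a := M.dualActive.orderEmbOfFin rfl with ha
  have hag : ∀ k, a k ∈ M.ground := fun k =>
    (Finset.mem_filter.1 (M.dualActive.orderEmbOfFin_mem rfl k)).1
  have hamem : ∀ k, a k ∈ M.cocircuitUnion (a k) := fun k => by
    obtain ⟨h1, D, hD, hDa, hle⟩ :=
      Finset.mem_filter.1 (M.dualActive.orderEmbOfFin_mem rfl k)
    exact mem_cocircuitUnion_iff.2 ⟨D, hD.1.1, hD.2, fun x hx => hle hx, hDa⟩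
  have hale : ∀ k, ∀ e ∈ M.cocircuitUnion (a k), a k ≤ e := fun k e he => by
    obtain ⟨X, hX, hpos, hle, he⟩ := mem_cocircuitUnion_iff.1 he
    exact hle e he
  have hout : ∀ k : Fin M.dualActive.card, a k ∉ M.activeFlat k := fun k =>
    (notMem_activeFlat_iff k.2 (hag k)).2 (hamem k)
  -- Here `a` is indexed from `0`, so `a k` lies in the part between sets `k` and `k + 1`. For the
  -- last `k` the set `k + 1` is the ground set and the claim is vacuous.
  have hnext : ∀ k : Fin M.dualActive.card, ∀ e ∈ M.ground, e ∉ M.activeFlat (k + 1) →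
      a k < e ∧ e ∉ M.activeFlat k := fun k e he hek => by
    by_cases hk : (k : ℕ) + 1 < M.dualActive.card
    · rw [notMem_activeFlat_iff hk he] at hek
      have hlt : a k < a ⟨k + 1, hk⟩ := a.strictMono (Fin.lt_def.2 (Nat.lt_succ_self _))
      exact ⟨hlt.trans_le (hale _ e hek),
        (notMem_activeFlat_iff k.2 he).2 (cocircuitUnion_anti hlt.le hek)⟩
    · exact absurd he (activeFlat_eq_ground_of_not_lt hk ▸ hek)
  have hin : ∀ k : Fin M.dualActive.card, a k ∈ M.activeFlat (k + 1) := fun k => by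
    by_contra h
    exact (hnext k _ (hag k) h).1.false
  have hsub : ∀ k : Fin M.dualActive.card, M.activeFlat k ⊆ M.activeFlat (k + 1) :=
    fun k e he => by
      by_contra h
      exact (hnext k e (activeFlat_subset_ground _ he) h).2 he
  have hmin : ∀ k : Fin M.dualActive.card,
      (M.activeFlat (k + 1) \ M.activeFlat k).min = a k := fun k => by
    refine le_antisymm (Finset.min_le (Finset.mem_sdiff.2 ⟨hin k, hout k⟩)) ?_
    refine Finset.le_min fun e he => WithTop.coe_le_coe.2 ?_
    obtain ⟨h1, h2⟩ := Finset.mem_sdiff.1 he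
    exact hale k e ((notMem_activeFlat_iff k.2 (activeFlat_subset_ground _ h1)).1 h2)
  refine ⟨Fin.strictMono_iff_lt_succ.2 fun k => ?_, ?_, ?_, fun k => ⟨a k, ?_, ?_, ?_, ?_⟩⟩
  · simp only [Fin.val_castSucc, Fin.val_succ]
    exact (Finset.ssubset_iff_of_subset (hsub k)).2 ⟨a k, hin k, hout k⟩
  · exact activeFlat_eq_ground_of_not_lt (by simp)
  · simp only [Fin.val_castSucc, Fin.val_succ, hmin]
    exact fun i j hij => WithTop.coe_lt_coe.2 (a.strictMono hij)
  · simpa only [Fin.val_castSucc, Fin.val_succ] using hmin k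
  · simp only [Fin.val_castSucc, Fin.val_succ]
    rw [minor_ground (activeFlat_subset_ground _)]
    exact Finset.mem_sdiff.2 ⟨hin k, hout k⟩
  · simp only [Fin.val_castSucc, Fin.val_succ]
    obtain ⟨X, hX, hpos, hXs⟩ := M.exists_covector_compl_activeFlat k
    refine IsAcyclic.of_covector (X := restr (M.activeFlat (k + 1)) X)
      ((mem_minor_covectors (hsub k)).2 ⟨X, hX, fun e he => ?_, rfl⟩)
      (isPositive_iff.2 fun e => ?_) fun e he => ?_
    · by_contra h
      exact ((hXs e).1 h).2 he
    · by_cases he : e ∈ M.activeFlat (k + 1)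
      · simpa [restr, he] using isPositive_iff.1 hpos e
      · simp [restr, he]
    · rw [minor_ground (activeFlat_subset_ground _), Finset.mem_coe, Finset.mem_sdiff] at he
      simpa [supp, restr, he.1] using (hXs e).2 ⟨activeFlat_subset_ground _ he.1, he.2⟩
  · simp only [Fin.val_castSucc, Fin.val_succ]
    intro D hD
    by_contra hDa
    obtain ⟨X, hX, hX0, rfl⟩ := (mem_minor_covectors (hsub k)).1 hD.1.1
    obtain ⟨e, he⟩ := exists_apply_ne_zero hD.1.2.1
    have hef : e ∈ M.activeFlat (k + 1) := by
      by_contra h; simp [restr, h] at he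
    have hXe : X e ≠ 0 := by simpa [restr, hef] using he
    have hXa : X (a k) = 0 := by
      by_contra h; exact hDa (by simpa [supp, restr, hin k] using h)
    -- `Y` masks the uncontrolled signs of the lift `X`, so `Y.comp X` is positive, and all of its
    -- support lies strictly above `a k`. The dual-active element `b` found for `e` therefore has
    -- index at least `k + 1`, which puts `e` outside the set `k + 1`.
    obtain ⟨Y, hY, hYpos, hYs⟩ := M.exists_covector_compl_activeFlat (k + 1)
    have hZpos : (Y.comp X).IsPositive := isPositive_iff.2 fun f => by
      by_cases hYf : Y f = 0
      · simp only [comp, hYf, if_true]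
        by_cases hf : f ∈ M.activeFlat (k + 1)
        · simpa [restr, hf] using isPositive_iff.1 hD.2 f
        · by_cases hfM : f ∈ M.ground
          · exact absurd hYf ((hYs f).2 ⟨hfM, hf⟩)
          · exact Or.inl (apply_eq_zero_of_notMem (M.supp_subset X hX) hfM)
      · simpa [comp, hYf] using isPositive_iff.1 hYpos f
    have hZmem := M.comp_mem Y hY X hX
    obtain ⟨b, hb, hbs, heb⟩ := exists_dualActive_le hZmem hZpos (e := e)
      (comp_apply_ne_zero.2 (Or.inr hXe))
    have hbg : b ∈ M.ground := M.supp_subset _ hZmem hbs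
    have hab : a k < b := by
      rcases comp_apply_ne_zero.1 hbs with h | h
      · exact (hnext k b hbg ((hYs b).1 h).2).1
      · have h1 : b ∉ M.activeFlat k := fun h' => h (hX0 b h')
        refine lt_of_le_of_ne (hale k b ((notMem_activeFlat_iff k.2 hbg).1 h1)) ?_
        rintro rfl
        exact h hXa
    obtain ⟨j, rfl⟩ : ∃ j, a j = b := by
      have : b ∈ Set.range a := by rw [ha, Finset.range_orderEmbOfFin]; exact hb
      exact this
    have hkj : k < j := a.strictMono.lt_iff_lt.1 hab
    have hk : (k : ℕ) + 1 < M.dualActive.card := lt_of_le_of_lt hkj j.2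
    refine (notMem_activeFlat_iff hk (M.supp_subset X hX hXe)).2
      (cocircuitUnion_anti (a.monotone ?_) heb) hef
    exact hkj

/-- The bound by the smallest dual-active element excludes no positive cocircuit. If there is no
dual-active element, there is no nonzero positive covector. -/
theorem mem_activeFlat_zero_iff {e : α} :
    e ∈ M.activeFlat 0 ↔ e ∈ M.ground ∧ ∀ X ∈ M.covectors, X.IsPositive → X e = 0 := by
  constructor
  · intro he
    refine ⟨activeFlat_subset_ground _ he, fun X hX hpos => ?_⟩
    by_contra hXe
    obtain ⟨a, ha, -, hea⟩ := exists_dualActive_le hX hpos hXe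
    have h0 : 0 < M.dualActive.card := Finset.card_pos.2 ⟨a, ha⟩
    refine (notMem_activeFlat_iff h0 (activeFlat_subset_ground _ he)).2 ?_ he
    refine cocircuitUnion_anti ?_ hea
    have : a ∈ Set.range (M.dualActive.orderEmbOfFin rfl) := by
      rw [Finset.range_orderEmbOfFin]; exact ha
    obtain ⟨j, rfl⟩ := this
    exact (M.dualActive.orderEmbOfFin rfl).monotone (Nat.zero_le _)
  · rintro ⟨he, h⟩
    by_contra hne
    obtain ⟨X, hX, hpos, hXs⟩ := M.exists_covector_compl_activeFlat 0
    exact (hXs e).2 ⟨he, hne⟩ (h X hX hpos)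

end Active

end OrientedMatroid

theorem SetSeq.eq_of_forall {α : Type*} {S T : SetSeq α} (hε : S.ε = T.ε) (hι : S.ι = T.ι)
    (hFc : S.Fc = T.Fc) (hF' : ∀ k, S.F' k = T.F' (Fin.cast (by rw [hε]) k))
    (hF : ∀ k, S.F k = T.F (Fin.cast (by rw [hι]) k)) : S = T := by
  obtain ⟨ε, ι, F', Fc, F⟩ := S
  obtain ⟨ε₂, ι₂, F'₂, Fc₂, F₂⟩ := T
  obtain rfl : ε = ε₂ := hε
  obtain rfl : ι = ι₂ := hι
  obtain rfl : Fc = Fc₂ := hFc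
  obtain rfl : F' = F'₂ := funext hF'
  obtain rfl : F = F₂ := funext hF
  rfl

/-! ### Reorientation. -/

namespace SignedSet

variable {α : Type*} [DecidableEq α]

theorem flip_flip_self (A : Finset α) (X : SignedSet α) : (X.flip A).flip A = X := by
  funext e
  simp only [flip]
  split_ifs <;> simp

theorem supp_flip (A : Finset α) (X : SignedSet α) : (X.flip A).supp = X.supp := by
  ext e
  simp only [supp, flip, Set.mem_ofPred_eq]
  split_ifs <;> simp

theorem flip_ne_zero {A : Finset α} {X : SignedSet α} (h : X ≠ 0) : X.flip A ≠ 0 := by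
  obtain ⟨e, he⟩ := exists_apply_ne_zero h
  refine ne_zero_of_apply (e := e) ?_
  rwa [← mem_supp, supp_flip]

theorem flip_orth_flip {A : Finset α} {X Y : SignedSet α} :
    (X.flip A).Orth (Y.flip A) ↔ X.Orth Y := by
  refine orth_congr fun e => ?_
  simp only [flip]
  split_ifs <;> simp

end SignedSet

namespace OrientedMatroid

open SignedSet

section Reorient

variable {α : Type*} [DecidableEq α]

theorem mem_reorient_vectors {M : OrientedMatroid α} {A : Finset α} {X : SignedSet α} :
    X ∈ (M.reorient A).vectors ↔ X.flip A ∈ M.vectors := by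
  simp only [vectors, Set.mem_ofPred_eq, supp_flip]
  refine and_congr_right fun _ => ⟨fun h Y hY => ?_, fun h Y hY => ?_⟩
  · rw [← flip_orth_flip (A := A), flip_flip_self]
    exact h _ (by simpa [reorient, flip_flip_self] using hY)
  · rw [← flip_orth_flip (A := A)]
    exact h _ hY

theorem reorient_reorient (M : OrientedMatroid α) (A : Finset α) :
    (M.reorient A).reorient A = M :=
  ext_covectors rfl fun X => by
    change (X.flip A).flip A ∈ M.covectors ↔ _
    rw [flip_flip_self]

theorem reorient_dual (M : OrientedMatroid α) (A : Finset α) :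
    (M.reorient A).dual = M.dual.reorient A :=
  ext_covectors rfl fun _ => mem_reorient_vectors

theorem IsCocircuit.flip {M : OrientedMatroid α} {D : SignedSet α} (h : M.IsCocircuit D)
    (A : Finset α) : (M.reorient A).IsCocircuit (D.flip A) := by
  refine ⟨?_, flip_ne_zero h.2.1, fun X hX hX0 hs => ?_⟩
  · change (D.flip A).flip A ∈ M.covectors
    rw [flip_flip_self]
    exact h.1
  · rw [supp_flip] at hs ⊢
    have := h.2.2 (X.flip A) hX (flip_ne_zero hX0)
    rw [supp_flip] at this
    exact this hs

theorem IsCircuit.flip {M : OrientedMatroid α} {C : SignedSet α} (h : M.IsCircuit C)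
    (A : Finset α) : (M.reorient A).IsCircuit (C.flip A) := by
  have := IsCocircuit.flip (M := M.dual) h A
  rwa [← reorient_dual] at this

theorem IsConnected.reorient {M : OrientedMatroid α} (h : M.IsConnected) (A : Finset α) :
    (M.reorient A).IsConnected := fun e he f hf hef => by
  obtain ⟨C, hC, h1, h2⟩ := h e he f hf hef
  exact ⟨C.flip A, hC.flip A, by rwa [supp_flip], by rwa [supp_flip]⟩

theorem IsLoop.reorient {M : OrientedMatroid α} (h : M.IsLoop) (A : Finset α) :
    (M.reorient A).IsLoop := by
  obtain ⟨e, he, C, hC, hs⟩ := h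
  exact ⟨e, he, C.flip A, hC.flip A, by rwa [supp_flip]⟩

theorem IsIsthmus.reorient {M : OrientedMatroid α} (h : M.IsIsthmus) (A : Finset α) :
    (M.reorient A).IsIsthmus := by
  obtain ⟨e, he, C, hC, hs⟩ := h
  exact ⟨e, he, C.flip A, hC.flip A, by rwa [supp_flip]⟩

theorem restr_flip (G A : Finset α) (X : SignedSet α) :
    restr G (X.flip A) = (restr G X).flip A := by
  funext e
  simp only [SignedSet.flip, restr]
  split_ifs <;> simp

theorem reorient_minor (M : OrientedMatroid α) (A G F : Finset α) :
    (M.reorient A).minor G F = (M.minor G F).reorient A := by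
  have h0 : ∀ (X : SignedSet α) e, X.flip A e = 0 ↔ X e = 0 := fun X e => by
    rw [← not_iff_not]
    change e ∈ (X.flip A).supp ↔ e ∈ X.supp
    rw [supp_flip]
  refine ext_covectors rfl fun X => and_congr ⟨?_, ?_⟩ ?_
  · rintro ⟨Y, hY, rfl⟩
    exact ⟨Y.flip A, hY, restr_flip G A Y⟩
  · rintro ⟨Y, hY, hYX⟩
    refine ⟨Y.flip A, ?_, ?_⟩
    · change (Y.flip A).flip A ∈ M.covectors
      rwa [flip_flip_self]
    · rw [restr_flip, hYX, flip_flip_self]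
  · simp only [h0]

end Reorient

theorem mem_cyclicPart_iff {α : Type*} {M : OrientedMatroid α} {e : α} :
    e ∈ M.cyclicPart ↔ ∃ X ∈ M.vectors, X.IsPositive ∧ X e ≠ 0 := by
  simp only [cyclicPart, Finset.mem_filter]
  constructor
  · rintro ⟨-, C, hC, hCe⟩
    exact ⟨C, hC.1.1, hC.2, hCe⟩
  · rintro ⟨X, hX, hpos, he⟩
    obtain ⟨C, hC, hCe, -⟩ := exists_posCircuit_subset hX hpos he
    exact ⟨hX.1 he, C, hC, hCe⟩

variable {α : Type*} [LinearOrder α]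

theorem IsConnectedFiltration.reorient {M : OrientedMatroid α} {S : SetSeq α}
    (h : M.IsConnectedFiltration S) (A : Finset α) :
    (M.reorient A).IsConnectedFiltration S where
  F'_last := h.F'_last
  F'_strictAnti := h.F'_strictAnti
  F'_zero := h.F'_zero
  F_zero := h.F_zero
  F_strictMono := h.F_strictMono
  F_last := h.F_last
  min_part := h.min_part
  min_part' := h.min_part'
  connected k := by
    rw [reorient_minor]
    refine ⟨(h.connected k).1.reorient A, fun hl => (h.connected k).2 ?_⟩
    have := hl.reorient A
    rwa [reorient_reorient] at this
  connected' k := by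
    rw [reorient_minor]
    refine ⟨(h.connected' k).1.reorient A, fun hl => (h.connected' k).2 ?_⟩
    have := hl.reorient A
    rwa [reorient_reorient] at this

/-! ### The decreasing half by duality, and assembly of both halves. -/

section DualChain

variable {M : OrientedMatroid α} {n : ℕ} {F : Fin (n + 1) → Finset α}

/-- Decreasing chains with dual-bounded minors are the complements of the chains with bounded
minors of the dual. -/
theorem isBoundedChain_dual_iff (hF : ∀ k, F k ⊆ M.ground) :
    M.dual.IsBoundedChain (fun k => M.ground \ F k) ↔
      StrictAnti F ∧ F (Fin.last n) = ∅ ∧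
      (StrictMono fun k : Fin n => (F k.castSucc \ F k.succ).min) ∧
      ∀ k : Fin n, ∃ p : α, (F k.castSucc \ F k.succ).min = p ∧
        (M.minor (F k.castSucc) (F k.succ)).IsDualBoundedAt p := by
  have hpart : ∀ k : Fin n, (M.ground \ F k.succ) \ (M.ground \ F k.castSucc) =
      F k.castSucc \ F k.succ := fun k => by
    ext e
    have := @hF k.castSucc e
    simp only [Finset.mem_sdiff]
    tauto
  have hanti : StrictMono (fun k => M.ground \ F k) ↔ StrictAnti F := by
    refine ⟨fun h i j hij => ?_, fun h i j hij => ?_⟩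
    · have h1 := h hij
      refine ⟨fun e he => ?_, fun h2 => h1.2 (Finset.sdiff_subset_sdiff le_rfl h2)⟩
      by_contra hei
      exact (Finset.mem_sdiff.1 (h1.1 (Finset.mem_sdiff.2 ⟨hF j he, hei⟩))).2 he
    · have h1 := h hij
      refine ⟨Finset.sdiff_subset_sdiff le_rfl h1.1, fun h2 => h1.2 fun e he => ?_⟩
      by_contra hej
      exact (Finset.mem_sdiff.1 (h2 (Finset.mem_sdiff.2 ⟨hF i he, hej⟩))).2 he
  have hlast : M.ground \ F (Fin.last n) = M.ground ↔ F (Fin.last n) = ∅ := by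
    rw [Finset.sdiff_eq_self_iff_disjoint]
    exact ⟨fun h => Finset.disjoint_self_iff_empty _ |>.1 (h.mono_left (hF _)), fun h => by
      rw [h]; exact Finset.disjoint_empty_right _⟩
  have hminor : StrictAnti F → ∀ (k : Fin n) (p : α),
      ((M.dual.minor (M.ground \ F k.succ) (M.ground \ F k.castSucc)).IsBoundedAt p ↔
        (M.minor (F k.castSucc) (F k.succ)).IsDualBoundedAt p) := fun h k p => by
    rw [isDualBoundedAt_iff_dual, minor_dual (h Fin.castSucc_lt_succ).le (hF _)]
  constructor
  · intro h
    have ha := hanti.1 h.strictMono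
    refine ⟨ha, hlast.1 h.last, ?_, fun k => ?_⟩
    · simpa only [hpart] using h.min_strictMono
    · obtain ⟨p, hp, hb⟩ := h.bounded k
      exact ⟨p, by rwa [hpart] at hp, (hminor ha k p).1 hb⟩
  · rintro ⟨ha, hl, hm, hb⟩
    refine ⟨hanti.2 ha, hlast.2 hl, by simpa only [hpart] using hm, fun k => ?_⟩
    obtain ⟨p, hp, hb⟩ := hb k
    exact ⟨p, by rwa [hpart], (hminor ha k p).2 hb⟩

end DualChain

variable {M : OrientedMatroid α}

theorem circuitUnion_subset_ground (a : α) : M.circuitUnion a ⊆ M.ground :=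
  cocircuitUnion_subset_ground (M := M.dual) a

/-- The active elements of `M` are by definition the dual-active elements of its dual, and likewise
for the unions, so both sides unfold to the same case distinction. -/
theorem activeFiltration_F' (k : Fin (M.active.card + 1)) :
    M.activeFiltration.F' k = M.ground \ M.dual.activeFlat k := by
  change (if h : (k : ℕ) < M.active.card then
      M.circuitUnion (M.active.orderEmbOfFin rfl ⟨k, h⟩) else ∅) =
    M.ground \ (if h : (k : ℕ) < M.active.card then
      M.ground \ M.circuitUnion (M.active.orderEmbOfFin rfl ⟨k, h⟩) else M.ground)
  split_ifs
  · rw [Finset.sdiff_sdiff_eq_self (circuitUnion_subset_ground _)]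
  · rw [Finset.sdiff_self]

/-- With `sdiff_dual_activeFlat_zero`, this shows that the two halves meet in `F_c`. Here the
dichotomy is needed: every element lies in a positive circuit or a positive cocircuit, never in
both. -/
theorem activeFlat_zero : M.activeFlat 0 = M.cyclicPart := by
  ext e
  rw [mem_activeFlat_zero_iff, mem_cyclicPart_iff]
  constructor
  · rintro ⟨he, h⟩
    rcases M.exists_posCocircuit_or_posCircuit he with ⟨D, hD, hDe⟩ | ⟨C, hC, hCe⟩
    · exact absurd (h D hD.1.1 hD.2) hDe
    · exact ⟨C, hC.1.1, hC.2, hCe⟩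
  · rintro ⟨X, hX, hpos, he⟩
    exact ⟨hX.1 he, fun Y hY hYpos =>
      (eq_zero_or_eq_zero_of_isPositive hX hY hpos hYpos e).resolve_left he⟩

theorem sdiff_dual_activeFlat_zero : M.ground \ M.dual.activeFlat 0 = M.cyclicPart := by
  ext e
  rw [Finset.mem_sdiff, mem_activeFlat_zero_iff, mem_cyclicPart_iff]
  constructor
  · rintro ⟨he, h⟩
    by_contra! hcon
    exact h ⟨he, hcon⟩
  · rintro ⟨X, hX, hpos, he⟩
    exact ⟨hX.1 he, fun h => he (h.2 X hX hpos)⟩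

theorem isFiltration_activeFiltration_and_hasBoundedMinors (M : OrientedMatroid α) :
    M.IsFiltration M.activeFiltration ∧ M.HasBoundedMinors M.activeFiltration := by
  have hF := M.isBoundedChain_activeFlat
  have hsub : ∀ k : Fin (M.active.card + 1), M.activeFiltration.F' k ⊆ M.ground := fun k => by
    rw [activeFiltration_F']
    exact Finset.sdiff_subset
  have hF' : M.dual.IsBoundedChain
      (fun k : Fin (M.active.card + 1) => M.ground \ M.activeFiltration.F' k) := by
    have heq : (fun k : Fin (M.active.card + 1) => M.ground \ M.activeFiltration.F' k) =
        fun k : Fin (M.dual.dualActive.card + 1) => M.dual.activeFlat k := by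
      funext k
      rw [activeFiltration_F']
      exact Finset.sdiff_sdiff_eq_self (activeFlat_subset_ground (M := M.dual) _)
    rw [heq]
    exact M.dual.isBoundedChain_activeFlat
  obtain ⟨h1, h2, h3, h4⟩ := (isBoundedChain_dual_iff hsub).1 hF'
  exact ⟨⟨h2, h1, (activeFiltration_F' 0).trans sdiff_dual_activeFlat_zero, activeFlat_zero,
    hF.strictMono, hF.last, hF.min_strictMono, h3⟩, hF.bounded, h4⟩

theorem HasBoundedMinors.isConnectedFiltration {S : SetSeq α} (hb : M.HasBoundedMinors S)
    (hS : M.IsFiltration S) : M.IsConnectedFiltration S where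
  toIsFiltration := hS
  connected k := by
    obtain ⟨p, -, hp⟩ := hb.1 k
    exact ⟨hp.isConnected, hp.not_isLoop⟩
  connected' k := by
    obtain ⟨p, -, hp⟩ := hb.2 k
    exact ⟨hp.isConnected, hp.not_isIsthmus⟩

theorem HasBoundedMinors.eq_activeFiltration {S : SetSeq α} (hb : M.HasBoundedMinors S)
    (hS : M.IsFiltration S) : S = M.activeFiltration := by
  have hF : M.IsBoundedChain S.F := ⟨hS.F_strictMono, hS.F_last, hS.min_part, hb.1⟩
  have hFc : S.Fc ⊆ M.ground := hS.F_zero ▸ hF.subset_ground 0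
  have hsub : ∀ k, S.F' k ⊆ M.ground := fun k =>
    (hS.F'_strictAnti.antitone (Fin.zero_le k)).trans (hS.F'_zero ▸ hFc)
  have hF' : M.dual.IsBoundedChain (fun k => M.ground \ S.F' k) :=
    (isBoundedChain_dual_iff hsub).2 ⟨hS.F'_strictAnti, hS.F'_last, hS.min_part', hb.2⟩
  -- The two halves certify each other: `X` is a positive covector with support the complement of
  -- `Fc`, and `Y` a positive vector with support `Fc`. So positive covectors vanish on `Fc` and
  -- positive vectors off it, which is what `IsBoundedChain.eq_activeFlat` asks of each chain.
  obtain ⟨X, hX, hXpos, hXs⟩ := hF.exists_isPositive_covector 0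
  obtain ⟨Y, hY, hYpos, hYs⟩ := hF'.exists_isPositive_covector 0
  rw [hS.F_zero] at hXs
  simp only [hS.F'_zero] at hYs
  obtain ⟨hι, hFk⟩ := hF.eq_activeFlat fun Z hZ hZpos e he => by
    rw [hS.F_zero] at he
    refine (eq_zero_or_eq_zero_of_isPositive hY hZ hYpos hZpos e).resolve_left ?_
    exact (hYs e).2 ⟨hFc he, by simp [he]⟩
  obtain ⟨hε, hF'k⟩ := hF'.eq_activeFlat fun Z hZ hZpos e he => by
    simp only [hS.F'_zero, Finset.mem_sdiff] at he
    exact (eq_zero_or_eq_zero_of_isPositive hZ hX hZpos hXpos e).resolve_right ((hXs e).2 he)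
  refine SetSeq.eq_of_forall hε hι ?_ (fun k => ?_) fun k => hFk k
  · rw [← hS.F_zero, hFk 0]
    exact activeFlat_zero
  · have h1 := activeFiltration_F' (M := M) (Fin.cast (by rw [hε]; rfl) k)
    rw [← Finset.sdiff_sdiff_eq_self (hsub k), hF'k k]
    exact h1.symm

end OrientedMatroid

theorem theorem4p6 {α : Type*} [LinearOrder α] (M : OrientedMatroid α) :
    (M.reorientations =
      ⋃ S ∈ {S : SetSeq α | M.IsConnectedFiltration S}, M.boundedReorientations S) ∧
    {S : SetSeq α | M.IsConnectedFiltration S}.PairwiseDisjoint M.boundedReorientations ∧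
    ∀ S : SetSeq α, M.IsConnectedFiltration S → ∀ A ∈ M.boundedReorientations S,
      S = (M.reorient A).activeFiltration := by
  have huniq : ∀ S : SetSeq α, M.IsConnectedFiltration S → ∀ A ∈ M.boundedReorientations S,
      S = (M.reorient A).activeFiltration := fun S hS A hA =>
    hA.2.eq_activeFiltration (hS.reorient A).toIsFiltration
  refine ⟨Set.Subset.antisymm (fun A hA => ?_) ?_, fun S hS T hT hST => ?_, huniq⟩
  · obtain ⟨h1, h2⟩ := (M.reorient A).isFiltration_activeFiltration_and_hasBoundedMinors
    -- The filtration is connected for the reorientation; reorienting along `A` once more makes it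
    -- one of `M`.
    have h3 := (h2.isConnectedFiltration h1).reorient A
    rw [OrientedMatroid.reorient_reorient] at h3
    exact Set.mem_biUnion h3 ⟨hA, h2⟩
  · exact Set.iUnion₂_subset fun S _ A hA => hA.1
  · refine Set.disjoint_left.2 fun A hAS hAT => hST ?_
    rw [huniq S hS A hAS, huniq T hT A hAT]
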